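/- **Setting.** Let $m\ge 1$ and consider $$\dot x=f(x)+\Delta f(x)+g(x)u,\qquad y=h(x),\qquad x\in\mathbb R^n,\ u\in\mathbb R^p,\ y\in\mathbb R^m,$$ on a bounded open set $X\subset\mathbb R^n$, where $f$, the columns $g_1,\dots,g_p$ of $g$ and $h$ are $C^\infty$ on $X$ and $\Delta f$ is $C^1$ on $X$. The nominal system has a vector relative degree $(r_1,\dots,r_m)$ at each point of $X$ with $\sum_i r_i=n$. Put $\xi=(L_f^{k}h_i)_{1\le i\le m,\,0\le k<r_i}$, $b=(L_f^{r_i}h_i)_i$ and $A=(L_{g_j}L_f^{r_i-1}h_i)_{ij}$, and let $A^{-1}$ be an inverse of $A$ (a right inverse if $p>m$). The uncertainty enters the linearized model as an unknown constant vector $\Delta=(\Delta_1,\dots,\Delta_m)^T$: $L_{\Delta f}L_f^kh_i=0$ for $k<r_i-1$ and $L_{\Delta f}L_f^{r_i-1}h_i=\Delta_i$ on $X$, i.e. $y^{(r)}=b+Au+\Delta$. The references $y_{id}$ are smooth, and the gains $K^i_j$ are such that all polynomials $s^{r_i}+K^i_{r_i}s^{r_i-1}+\dots+K^i_1$ are Hurwitz.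 Let $e_i=y_i-y_{id}$ and $z=(e_i,\dot e_i,\dots,e_i^{(r_i-1)})_{i}$; let $\tilde A$ be the block diagonal matrix of the companion blocks of these polynomials, $\tilde B$ the $n\times m$ matrix whose $i$-th block has its only nonzero entry, $1$, in row $r_i$ and column $i$, and $P>0$ the solution of $\tilde A^TP+P\tilde A=-I$. Let $L$ be a bounded function of $\xi$ with $\|\Delta\|\le\|\Delta\|\,\|L(\xi)\|$. The controller is $u=u_n+u_r$, $$u_n=A^{-1}(v_s-b),\quad v_{si}=y_{id}^{(r_i)}-\sum_{j=1}^{r_i}K^i_j e_i^{(j-1)},\quad u_r=-A^{-1}\tilde B^TPz\,\|L(\xi)\|^2-A^{-1}\|\widehat\Delta(t)\|\,\|L(\xi)\|\,\mathrm{sign}(\tilde B^TPz).$$ The estimate $\widehat\Delta(t)$ is produced by the extremum-seeking law $$\dot \eta_i=a_i\sin\!\big(\omega_it+\tfrac{\pi}{2}\big)J(\widehat\Delta),\qquad \widehat\Delta_i=\eta_i+a_i\sin\!\big(\omega_it-\tfrac{\pi}{2}\big),\qquad i=1,\dots,m,$$ with $a_i>0$. The frequencies are called admissible if $\omega_i\ne\omega_j$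 for $i\neq j$ and $\omega_i+\omega_j\ne\omega_k$ for all $i,j,k$. A cost is a function $J(\widehat\Delta)=F(z(\widehat\Delta))$ on $\mathbb R^m$, with a map $\widehat\Delta\mapsto z(\widehat\Delta)\in\mathbb R^n$, $F(0)=0$ and $F(z)>0$ for $z\ne0$, that has a local minimum at $\Delta$ and, on a compact neighbourhood of $\Delta$, is analytic with $\|\partial J/\partial\widehat\Delta\|\le\xi_2$ for some $\xi_2>0$. Let $e_\Delta=\Delta-\widehat\Delta$ and $\omega_0=\max_i\omega_i$. Solutions with the discontinuous sign are understood in Filippov's sense, and are considered as long as they exist with $x(t)\in X$. For $\beta,\tilde\beta\in\mathcal{KL}$, $\gamma\in\mathcal K$, $\xi_1>0$ and a neighbourhood $\mathcal D_e$ of $0\in\mathbb R^m$, consider the property that every solution with $e_\Delta(0)\in\mathcal D_e$ satisfies $$\|z(t)\|\le\beta(\|z(0)\|,t)+\gamma\Big(\tilde\beta(\|e_\Delta(0)\|,t)+\frac{\xi_1}{\omega_0}+\sqrt{\textstyle\sum_{i=1}^m a_i^2}\Big).\qquad(\ast)$$ **Claim.** There are $\beta\in\mathcal{KL}$ and $\gamma\in\mathcal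 K$ that depend only on the controlled system (not on $J$, the $a_i$, the $\omega_i$ or the initial data) such that: 1. For all amplitudes $a_i>0$ there is $\gamma'\in\mathcal K$ such that for every cost $J$ there are $\mathcal D_e$, $\tilde\beta\in\mathcal{KL}$, $\xi_1>0$ and $\omega^*>0$ for which $(\ast)$, with $\gamma'$ in place of $\gamma$, holds for all admissible frequencies with $\omega_i>\omega^*$ for all $i$. 2. If the minimum of $J$ at $\Delta$ is nondegenerate, i.e. $J(\widehat\Delta)\ge J(\Delta)+c\|\widehat\Delta-\Delta\|^2$ near $\Delta$ for some $c>0$, then $(\ast)$ holds with the above $\gamma$ for small amplitudes: for all $\bar a_i>0$ there are $\mathcal D_e$ and $\varepsilon_0>0$ such that for each $\varepsilon\in(0,\varepsilon_0)$ there is $\tilde\beta\in\mathcal{KL}$ such that for all admissible positive $\bar\omega_1,\dots,\bar\omega_m$ there are $\xi_1>0$ and $\omega^*>0$ for which $(\ast)$ holds with $a_i=\varepsilon\bar a_i$ and $\omega_i=\kappa\bar\omega_i$ whenever $\kappa\bar\omega_i>\omega^*$ for all $i$. -/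

import Mathlib

open scoped ContDiff Topology Matrix

noncomputable section

/-- Class `K` functions on `[0, ∞)`. -/
def ClassK (γ : ℝ → ℝ) : Prop :=
  ContinuousOn γ (Set.Ici 0) ∧ StrictMonoOn γ (Set.Ici 0) ∧ γ 0 = 0

/-- Class `KL` functions on `[0, ∞) × [0, ∞)`; `β r s` is of class `K` in `r` and decreases to `0`
in `s`. -/
def ClassKL (β : ℝ → ℝ → ℝ) : Prop :=
  ContinuousOn (fun q : ℝ × ℝ => β q.1 q.2) (Set.Ici 0 ×ˢ Set.Ici 0) ∧
    (∀ s, 0 ≤ s → ClassK fun r => β r s) ∧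
    ∀ r, 0 ≤ r → AntitoneOn (β r) (Set.Ici 0) ∧
      Filter.Tendsto (β r) Filter.atTop (𝓝 0)

/-- `ℝⁿ` with the Euclidean norm. -/
abbrev Vec (n : ℕ) : Type := EuclideanSpace ℝ (Fin n)

/-- Matrix times vector, in Euclidean spaces. -/
def act {ι κ : Type*} [Fintype ι] (M : Matrix κ ι ℝ) (v : EuclideanSpace ℝ ι) :
    EuclideanSpace ℝ κ :=
  WithLp.toLp 2 (M *ᵥ v.ofLp)

/-- Lie derivative of a function along a vector field. -/
def lieD {n : ℕ} (f : Vec n → Vec n) (φ : Vec n → ℝ) (x : Vec n) : ℝ :=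
  fderiv ℝ φ x (f x)

/-- Iterated Lie derivative along a vector field. -/
def lieIter {n : ℕ} (f : Vec n → Vec n) (k : ℕ) (φ : Vec n → ℝ) : Vec n → ℝ :=
  (lieD f)^[k] φ

/-- The data of the uncertain system `ẋ = f(x) + Δf(x) + g(x) u`, `y = h(x)` on `X`, and of its
tracking controller. `g j` is the `j`-th column of `g`, `gain i j` is `K^i_{j+1}`, `unc` is the
vector of unknown parameters `Δ`, and `rinv x` is the (right) inverse of the decoupling matrix.
The coordinates `ξ` and the error `z` are indexed by the pairs `(i, k)`, `k < r i`. -/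
structure TrackingLoop (n p m : ℕ) where
  X : Set (Vec n)
  f : Vec n → Vec n
  df : Vec n → Vec n
  g : Fin p → Vec n → Vec n
  h : Fin m → Vec n → ℝ
  r : Fin m → ℕ
  yd : Fin m → ℝ → ℝ
  gain : (i : Fin m) → Fin (r i) → ℝ
  P : Matrix ((i : Fin m) × Fin (r i)) ((i : Fin m) × Fin (r i)) ℝ
  L : EuclideanSpace ℝ ((i : Fin m) × Fin (r i)) → Vec m
  rinv : Vec n → Matrix (Fin p) (Fin m) ℝ
  unc : Vec m

namespace TrackingLoop

variable {n p m : ℕ} (S : TrackingLoop n p m)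

/-- The space of the linearizing coordinates and of the tracking errors. -/
abbrev ErrorSpace : Type := EuclideanSpace ℝ ((i : Fin m) × Fin (S.r i))

/-- The coordinates `ξ = (y_i, ẏ_i, …, y_i^{(r_i - 1)})_i` as functions of the state. -/
def coord (x : Vec n) : S.ErrorSpace :=
  WithLp.toLp 2 fun q => lieIter S.f q.2 (S.h q.1) x

/-- The drift `b` of the linearized model, `b_i = L_f^{r_i} h_i`. -/
def drift (x : Vec n) : Vec m :=
  WithLp.toLp 2 fun i => lieIter S.f (S.r i) (S.h i) x

/-- The decoupling matrix `A`, with entries `L_{g_j} L_f^{r_i - 1} h_i`. -/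
def decoupling (x : Vec n) : Matrix (Fin m) (Fin p) ℝ :=
  Matrix.of fun i j => lieD (S.g j) (lieIter S.f (S.r i - 1) (S.h i)) x

/-- Vector relative degree `(r_1, …, r_m)` of the nominal system at a point. -/
def HasRelativeDegreeAt (x₀ : Vec n) : Prop :=
  (∀ i, 1 ≤ S.r i) ∧
    (∀ i j k, k + 1 < S.r i → ∀ᶠ x in 𝓝 x₀, lieD (S.g j) (lieIter S.f k (S.h i)) x = 0) ∧
    (S.decoupling x₀).rank = m

/-- The uncertainty `Δf` enters the linearized model as the additive term `Δb(ξ)`: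
it does not enter `y_i^{(k)}` for `k < r_i`, and `y^{(r)} = b + A u + Δb(ξ)`. -/
def IsMatched (db : S.ErrorSpace → Vec m) : Prop :=
  ContDiffOn ℝ 1 db (S.coord '' S.X) ∧
    ∀ x ∈ S.X, ∀ i,
      (∀ k, k + 1 < S.r i → lieD S.df (lieIter S.f k (S.h i)) x = 0) ∧
      lieD S.df (lieIter S.f (S.r i - 1) (S.h i)) x = db (S.coord x) i

/-- The companion block `Ã_i`. -/
def companion (i : Fin m) : Matrix (Fin (S.r i)) (Fin (S.r i)) ℝ :=
  Matrix.of fun k l =>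
    if (k : ℕ) + 1 = S.r i then -S.gain i l else if (l : ℕ) = k + 1 then 1 else 0

/-- The matrix `Ã = diag(Ã_1, …, Ã_m)`. -/
def matA : Matrix ((i : Fin m) × Fin (S.r i)) ((i : Fin m) × Fin (S.r i)) ℝ :=
  Matrix.blockDiagonal' S.companion

/-- The matrix `B̃`. -/
def matB : Matrix ((i : Fin m) × Fin (S.r i)) (Fin m) ℝ :=
  Matrix.of fun q j => if (q.2 : ℕ) + 1 = S.r q.1 ∧ j = q.1 then 1 else 0

/-- The standing assumptions on the system, the references and the controller. -/
structure Admissible : Prop where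
  isOpen : IsOpen S.X
  bounded : Bornology.IsBounded S.X
  smooth_f : ContDiffOn ℝ ∞ S.f S.X
  smooth_g : ∀ j, ContDiffOn ℝ ∞ (S.g j) S.X
  smooth_h : ∀ i, ContDiffOn ℝ ∞ (S.h i) S.X
  smooth_df : ContDiffOn ℝ 1 S.df S.X
  relDegree : ∀ x ∈ S.X, S.HasRelativeDegreeAt x
  linearizable : ∑ i, S.r i = n
  smooth_yd : ∀ i, ContDiff ℝ ∞ (S.yd i)
  /-- the uncertainty in the linearized model is the constant vector `Δ` -/
  matched : S.IsMatched fun _ => S.unc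
  hurwitz : ∀ i, ∀ s : ℂ,
    s ^ S.r i + ∑ j : Fin (S.r i), (S.gain i j : ℂ) * s ^ (j : ℕ) = 0 → s.re < 0
  posDef : S.P.PosDef
  lyapunov : S.matAᵀ * S.P + S.P * S.matA = -1
  L_bounded : ∃ C, ∀ x ∈ S.X, ‖S.L (S.coord x)‖ ≤ C
  /-- `‖Δb‖ ≤ ‖Δ‖ ‖L(ξ)‖` for the constant `Δb = Δ` -/
  unc_bound : ∀ x ∈ S.X, ‖S.unc‖ ≤ ‖S.unc‖ * ‖S.L (S.coord x)‖
  rinv_spec : ∀ x ∈ S.X, S.decoupling x * S.rinv x = 1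

/-- The tracking error `z = (e_i, ė_i, …, e_i^{(r_i - 1)})_i`, `e_i = y_i - y_{id}`,
at time `t` and state `x`. -/
def err (t : ℝ) (x : Vec n) : S.ErrorSpace :=
  WithLp.toLp 2 fun q => S.coord x q - iteratedDeriv q.2 (S.yd q.1) t

/-- The stabilizing virtual input `v_s`. -/
def virtualInput (t : ℝ) (x : Vec n) : Vec m :=
  WithLp.toLp 2 fun i =>
    iteratedDeriv (S.r i) (S.yd i) t - ∑ j : Fin (S.r i), S.gain i j * S.err t x ⟨i, j⟩

/-- The vector `B̃ᵀ P z`. -/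
def switching (t : ℝ) (x : Vec n) : Vec m :=
  act (S.matBᵀ * S.P) (S.err t x)

/-- The nominal controller `u_n = A⁻¹ (v_s - b)`. -/
def nominalInput (t : ℝ) (x : Vec n) : Vec p :=
  act (S.rinv x) (S.virtualInput t x - S.drift x)

/-- The robust controller `u_r = -A⁻¹ B̃ᵀPz ‖L(ξ)‖² - A⁻¹ ‖Δ̂‖ ‖L(ξ)‖ sign(B̃ᵀPz)`, where `sgn`
stands for the value of the signum vector. -/
def robustInput (t : ℝ) (x : Vec n) (est sgn : Vec m) : Vec p :=
  -act (S.rinv x) (‖S.L (S.coord x)‖ ^ 2 • S.switching t x)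
    - act (S.rinv x) ((‖est‖ * ‖S.L (S.coord x)‖) • sgn)

/-- The right-hand side `f + Δf + g u` under `u = u_n + u_r`. -/
def closedLoopField (t : ℝ) (x : Vec n) (est sgn : Vec m) : Vec n :=
  S.f x + S.df x + ∑ j, (S.nominalInput t x + S.robustInput t x est sgn) j • S.g j x

end TrackingLoop

/-- `s` is a value at `v` of the set-valued signum: `sign v_i` if `v_i ≠ 0`, and
anything in `[-1, 1]` if `v_i = 0`. -/
def IsSignValue {m : ℕ} (v s : Vec m) : Prop :=
  ∀ i, (0 < v i → s i = 1) ∧ (v i < 0 → s i = -1) ∧ |s i| ≤ 1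

/-- The estimate `Δ̂_i(t) = η_i(t) + a_i sin(w_i t - π/2)`. -/
def estimate {m : ℕ} (a w : Fin m → ℝ) (η : ℝ → Vec m) (t : ℝ) : Vec m :=
  WithLp.toLp 2 fun i => η t i + a i * Real.sin (w i * t - Real.pi / 2)

/-- Solutions on `[0, T]`, inside `X`, of the closed loop made of the controlled system and the
extremum-seeking law `η̇_i = a_i sin(w_i t + π/2) J(Δ̂)`. The system equation, whose right-hand side
is discontinuous, is understood in Filippov's sense: `x` is absolutely continuous and
satisfies it almost everywhere, with some value `sgn t` of the set-valued signum. -/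
structure IsClosedLoopSolution {n p m : ℕ} (S : TrackingLoop n p m) (J : Vec m → ℝ)
    (a w : Fin m → ℝ) (T : ℝ) (x : ℝ → Vec n) (sgn : ℝ → Vec m) (η : ℝ → Vec m) : Prop where
  mem : ∀ t ∈ Set.Icc 0 T, x t ∈ S.X
  sign : ∀ t ∈ Set.Icc 0 T, IsSignValue (S.switching t (x t)) (sgn t)
  integrable : IntervalIntegrable
    (fun t => S.closedLoopField t (x t) (estimate a w η t) (sgn t)) MeasureTheory.volume 0 T
  state : ∀ t ∈ Set.Icc 0 T,
    x t = x 0 + ∫ s in (0 : ℝ)..t, S.closedLoopField s (x s) (estimate a w η s) (sgn s)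
  seek : ∀ t ∈ Set.Icc 0 T, ∀ i,
    HasDerivWithinAt (fun s => η s i)
      (a i * Real.sin (w i * t + Real.pi / 2) * J (estimate a w η t)) (Set.Icc 0 T) t

/-- Distinct frequencies, none of which is the sum of two. -/
def NonResonant {m : ℕ} (w : Fin m → ℝ) : Prop :=
  (∀ i j, i ≠ j → w i ≠ w j) ∧ ∀ i j k, w i + w j ≠ w k

/-- `J` is a cost function `J(Δ̂) = F(z(Δ̂))` with `F` positive definite, it has a local minimum at
`Δ`, and on a compact neighbourhood of `Δ` it is analytic with bounded gradient. -/
def TrackingLoop.IsCost {n p m : ℕ} (S : TrackingLoop n p m) (J : Vec m → ℝ) : Prop :=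
  (∃ (F : S.ErrorSpace → ℝ) (ζ : Vec m → S.ErrorSpace),
      F 0 = 0 ∧ (∀ z, z ≠ 0 → 0 < F z) ∧ ∀ θ, J θ = F (ζ θ)) ∧
    IsLocalMin J S.unc ∧
    ∃ V ∈ 𝓝 S.unc, IsCompact V ∧ AnalyticOnNhd ℝ J V ∧
      ∃ ξ₂ : ℝ, 0 < ξ₂ ∧ ∀ θ ∈ V, ‖fderiv ℝ J θ‖ ≤ ξ₂

/-- Quadratic growth at `θ₀`; for a smooth `J` with a local minimum at `θ₀` this says that the
Hessian there is positive definite. -/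
def IsNondegenerateMin {m : ℕ} (J : Vec m → ℝ) (θ₀ : Vec m) : Prop :=
  ∃ c : ℝ, 0 < c ∧ ∀ᶠ θ in 𝓝 θ₀, J θ₀ + c * ‖θ - θ₀‖ ^ 2 ≤ J θ

/-- Every closed-loop solution whose initial estimation error `e_Δ(0)` lies in `D` satisfies
`‖z(t)‖ ≤ β(‖z(0)‖, t) + γ(β'(‖e_Δ(0)‖, t) + ξ₁ / w₀ + √(∑ a_i²))`, with `w₀ = max w_i`, as long as
it exists. -/
def TrackingLoop.BoundHolds {n p m : ℕ} (S : TrackingLoop n p m) (J : Vec m → ℝ)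
    (a w : Fin m → ℝ) (D : Set (Vec m)) (β : ℝ → ℝ → ℝ) (γ : ℝ → ℝ) (β' : ℝ → ℝ → ℝ)
    (ξ₁ : ℝ) : Prop :=
  ∀ (T : ℝ) (x : ℝ → Vec n) (sgn η : ℝ → Vec m), 0 < T →
    IsClosedLoopSolution S J a w T x sgn η →
    S.unc - estimate a w η 0 ∈ D →
    ∀ t ∈ Set.Icc 0 T,
      ‖S.err t (x t)‖ ≤ β ‖S.err 0 (x 0)‖ t
        + γ (β' ‖S.unc - estimate a w η 0‖ t + ξ₁ / (⨆ i, w i) + √(∑ i, a i ^ 2))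

end

/-! The proof splits into a robust-control estimate and an averaging estimate. Take `V = zᵀPz` along
a closed-loop solution. Feedback linearization leaves `ż = Ãz + B̃d`, and the Lyapunov equation
gives `V' = -‖z‖² + 2 d·(B̃ᵀPz)`. The sign term cancels `Δ` up to `‖Δ‖ - ‖Δ̂‖`, and the quadratic
damping absorbs the rest by completing a square, so `V'` exceeds `-‖z‖²` by at most half the square
of any bound for that difference. Comparison then yields `Admissible.exists_iss`: exponential decay
plus a linear gain, with constants depending only on `P`.

For arbitrary amplitudes no convergence of the estimate is needed. Always `‖Δ‖ - ‖Δ̂‖ ≤ ‖Δ‖`, and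
since `γ'` may depend on the amplitudes, a steep linear `γ'` evaluated at `√(∑ a_i²) > 0` already
dominates this constant.

At a nondegenerate minimum, divide each coordinate of the parameter error by its amplitude; all
channels then carry a common small amplitude `ε`. Expand the cost to second order in the dither and
differentiate `‖y‖²`. By non-resonance every oscillating product has mean zero, except the square of
each dither component, of mean `1/2`; the mean drift is `-ε² G'(y)y ≤ -ε² c‖y‖²`. A corrector of
size `1/κ` removes the oscillations (`exists_averaging_bound`), and a first-exit argument keeps the
trajectory where the expansion is valid (`exists_seek_bound`). Choosing the Taylor error small
relative to the growth constant makes the residual radius exactly `ε`, whatever the cost. Hence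
`exists_estimate_bound` has the universal factor `√m + 2`, which is why `γ` does not depend on `J`.
-/

/-- A function whose increments are dominated by those of an absolutely continuous function is
absolutely continuous. -/
theorem AbsolutelyContinuousOnInterval.of_dist_le {Y Z : Type*} [PseudoMetricSpace Y]
    [PseudoMetricSpace Z] {f : ℝ → Y} {g : ℝ → Z} {a b K : ℝ}
    (hg : AbsolutelyContinuousOnInterval g a b)
    (h : ∀ s ∈ Set.uIcc a b, ∀ t ∈ Set.uIcc a b, dist (f s) (f t) ≤ K * dist (g s) (g t)) :
    AbsolutelyContinuousOnInterval f a b := by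
  refine squeeze_zero' (.of_forall fun E => Finset.sum_nonneg fun _ _ => dist_nonneg) ?_
    (by simpa using Filter.Tendsto.const_mul K hg)
  filter_upwards [Filter.mem_inf_of_right (Filter.mem_principal_self _)] with E hE
  rw [Finset.mul_sum]
  exact Finset.sum_le_sum fun i hi => h _ (hE.1 i hi).1 _ (hE.1 i hi).2

/-! ### Chain rule along absolutely continuous curves. -/

section Chain

variable {E : Type*} [NormedAddCommGroup E] [NormedSpace ℝ E]

/-- The curve `t ↦ (t, x₀ + ∫₀ᵗ F)` is absolutely continuous. -/
theorem absolutelyContinuousOnInterval_graph {F x : ℝ → E} {T : ℝ} (hT : 0 ≤ T)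
    (hF : IntervalIntegrable F MeasureTheory.volume 0 T)
    (hx : ∀ t ∈ Set.Icc 0 T, x t = x 0 + ∫ s in (0 : ℝ)..t, F s) :
    AbsolutelyContinuousOnInterval (fun t => (t, x t)) 0 T := by
  have hu : Set.uIcc 0 T = Set.Icc 0 T := Set.uIcc_of_le hT
  have h1 := hF.norm.absolutelyContinuousOnInterval_intervalIntegral (c := 0) (by simp)
  have h2 : AbsolutelyContinuousOnInterval (fun t : ℝ => t) 0 T :=
    (LipschitzWith.id.lipschitzOnWith).absolutelyContinuousOnInterval
  -- The scalar function `t + ∫₀ᵗ ‖F‖` controls both components of the graph in the maximum norm.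
  refine (h2.fun_add h1).of_dist_le (K := 1) ?_
  rw [hu]
  have key : ∀ s ∈ Set.Icc 0 T, ∀ t ∈ Set.Icc 0 T, s ≤ t → dist (s, x s) (t, x t) ≤
      1 * dist (s + ∫ v in (0 : ℝ)..s, ‖F v‖) (t + ∫ v in (0 : ℝ)..t, ‖F v‖) := by
    intro s hs t ht hst
    have hi : ∀ r ∈ Set.Icc 0 T, IntervalIntegrable F MeasureTheory.volume 0 r := fun r hr =>
      hF.mono_set (by rw [hu, Set.uIcc_of_le hr.1]; exact Set.Icc_subset_Icc_right hr.2)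
    have h3 : ‖x t - x s‖ ≤ (∫ v in (0 : ℝ)..t, ‖F v‖) - ∫ v in (0 : ℝ)..s, ‖F v‖ := by
      rw [hx t ht, hx s hs, add_sub_add_left_eq_sub,
        intervalIntegral.integral_interval_sub_left (hi t ht) (hi s hs),
        intervalIntegral.integral_interval_sub_left (hi t ht).norm (hi s hs).norm]
      exact intervalIntegral.norm_integral_le_integral_norm hst
    have h4 := norm_nonneg (x t - x s)
    rw [Prod.dist_eq, dist_comm s t, dist_comm (x s), dist_comm (s + _), dist_eq_norm (x t),
      Real.dist_eq, Real.dist_eq, abs_of_nonneg (by linarith), abs_of_nonneg (by linarith)]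
    exact max_le (by linarith) (by linarith)
  intro s hs t ht
  rcases le_total s t with h | h
  · exact key s hs t ht h
  · rw [dist_comm, dist_comm (s + _)]
    exact key t ht s hs h

/-- A primitive is differentiable almost everywhere. -/
theorem ae_hasDerivAt_of_eq_integral [CompleteSpace E] {F x : ℝ → E} {T : ℝ} (hT : 0 ≤ T)
    (hF : IntervalIntegrable F MeasureTheory.volume 0 T)
    (hx : ∀ t ∈ Set.Icc 0 T, x t = x 0 + ∫ s in (0 : ℝ)..t, F s) :
    ∀ᵐ t, t ∈ Set.Ioo 0 T → HasDerivAt x (F t) t := by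
  filter_upwards [hF.ae_hasDerivAt_integral] with t ht hmem
  have hu : Set.uIcc 0 T = Set.Icc 0 T := Set.uIcc_of_le hT
  have h1 := (ht (hu ▸ Set.Ioo_subset_Icc_self hmem) 0 (by simp)).const_add (x 0)
  refine h1.congr_of_eventuallyEq ?_
  filter_upwards [isOpen_Ioo.mem_nhds hmem] with s hs
  exact hx s (Set.Ioo_subset_Icc_self hs)

/-- A `C¹` function of an absolutely continuous curve is absolutely continuous. -/
theorem AbsolutelyContinuousOnInterval.comp_contDiffOn {Y : Type*} [NormedAddCommGroup Y]
    [NormedSpace ℝ Y] {Φ : Y → ℝ} {U : Set Y} (hU : IsOpen U) (hΦ : ContDiffOn ℝ 1 Φ U)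
    {c : ℝ → Y} {a b : ℝ} (hc : AbsolutelyContinuousOnInterval c a b)
    (hcU : ∀ t ∈ Set.uIcc a b, c t ∈ U) :
    AbsolutelyContinuousOnInterval (fun t => Φ (c t)) a b := by
  have hcomp : IsCompact (c '' Set.uIcc a b) := isCompact_uIcc.image_of_continuousOn hc.continuousOn
  have hL : LocallyLipschitzOn (c '' Set.uIcc a b) Φ := by
    rintro _ ⟨t, ht, rfl⟩
    obtain ⟨K, s, hs, hK⟩ :=
      (hΦ.contDiffAt (hU.mem_nhds (hcU t ht))).exists_lipschitzOnWith
    exact ⟨K, s, mem_nhdsWithin_of_mem_nhds hs, hK⟩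
  obtain ⟨K, hK⟩ := hL.exists_lipschitzOnWith_of_compact hcomp
  exact hc.of_dist_le fun s hs t ht =>
    hK.dist_le_mul _ (Set.mem_image_of_mem c hs) _ (Set.mem_image_of_mem c ht)

end Chain

/-- An absolutely continuous function with nonpositive derivative almost everywhere decreases. -/
theorem AbsolutelyContinuousOnInterval.le_of_ae_deriv_nonpos {u : ℝ → ℝ} {T : ℝ} (hT : 0 ≤ T)
    (hu : AbsolutelyContinuousOnInterval u 0 T)
    (h : ∀ᵐ t, t ∈ Set.Ioo 0 T → ∃ v, HasDerivAt u v t ∧ v ≤ 0) : u T ≤ u 0 := by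
  have h1 := hu.integral_deriv_eq_sub
  have h2 : ∫ t in (0 : ℝ)..T, deriv u t ≤ 0 := by
    rw [intervalIntegral.integral_of_le hT, MeasureTheory.integral_Ioc_eq_integral_Ioo]
    refine MeasureTheory.integral_nonpos_of_ae ?_
    rw [Filter.EventuallyLE, MeasureTheory.ae_restrict_iff' measurableSet_Ioo]
    filter_upwards [h] with t ht ht'
    obtain ⟨v, hv, hv'⟩ := ht ht'
    rw [hv.deriv]; exact hv'
  linarith

/-! ### Comparison lemmas. -/

section Comparison

variable {u : ℝ → ℝ} {l a μ b : ℝ}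

/-- The function `(2a/l) e^{-μt} + b/l` is a supersolution of `x' = -l x + a e^{-μt} + b`: since `μ
≤ l/2`, differentiating the exponential costs at most `a e^{-μt}`, half of what `l` times it
supplies. Multiplying by `e^{lt}` turns this into monotonicity. -/
theorem comparison_hasDerivAt (hl : 0 < l) (ha : 0 ≤ a) (hμ : μ ≤ l / 2) {t v : ℝ}
    (hv : HasDerivAt u v t) (hle : v ≤ -l * u t + a * Real.exp (-μ * t) + b) :
    ∃ v', HasDerivAt (fun s => Real.exp (l * s) * (u s - 2 / l * a * Real.exp (-μ * s) - b / l))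
      v' t ∧ v' ≤ 0 := by
  have e1 : HasDerivAt (fun s => Real.exp (l * s)) (Real.exp (l * t) * (l * 1)) t :=
    ((hasDerivAt_id t).const_mul l).exp
  have e2 : HasDerivAt (fun s => Real.exp (-μ * s)) (Real.exp (-μ * t) * (-μ * 1)) t :=
    ((hasDerivAt_id t).const_mul (-μ)).exp
  refine ⟨_, e1.mul ((hv.sub (e2.const_mul (2 / l * a))).sub_const (b / l)), ?_⟩
  have h3 : 2 / l * a * (Real.exp (-μ * t) * μ) ≤ a * Real.exp (-μ * t) := by
    have : 2 / l * μ ≤ 1 := by rw [div_mul_eq_mul_div, div_le_one hl]; linarith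
    have h4 : 0 ≤ a * Real.exp (-μ * t) := by positivity
    nlinarith
  have h5 : l * (2 / l * a * Real.exp (-μ * t)) = 2 * (a * Real.exp (-μ * t)) := by
    field_simp
  have h6 : l * (b / l) = b := by field_simp
  have h7 : 0 < Real.exp (l * t) := Real.exp_pos _
  have h8 : l * (u t - 2 / l * a * Real.exp (-μ * t) - b / l)
      + (v - 2 / l * a * (Real.exp (-μ * t) * (-μ * 1))) ≤ 0 := by
    linarith
  have := mul_nonpos_of_nonneg_of_nonpos h7.le h8
  linarith

theorem comparison_le (hl : 0 < l) (ha : 0 ≤ a) (hb : 0 ≤ b) {t : ℝ}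
    (h : Real.exp (l * t) * (u t - 2 / l * a * Real.exp (-μ * t) - b / l)
      ≤ Real.exp (l * 0) * (u 0 - 2 / l * a * Real.exp (-μ * 0) - b / l)) :
    u t ≤ Real.exp (-l * t) * u 0 + 2 / l * a * Real.exp (-μ * t) + b / l := by
  have h1 : Real.exp (l * 0) * (u 0 - 2 / l * a * Real.exp (-μ * 0) - b / l) ≤ u 0 := by
    have : 0 ≤ 2 / l * a := by positivity
    have : 0 ≤ b / l := by positivity
    simp; linarith
  have h2 := mul_le_mul_of_nonneg_left (h.trans h1) (Real.exp_pos (-l * t)).le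
  rw [← mul_assoc, ← Real.exp_add] at h2
  simp at h2
  simp only [neg_mul]
  linarith

/-- Comparison lemma for absolutely continuous functions, with a decaying forcing term. -/
theorem AbsolutelyContinuousOnInterval.comparison (hl : 0 < l) (ha : 0 ≤ a) (hb : 0 ≤ b)
    (hμ : μ ≤ l / 2) {T : ℝ} (hu : AbsolutelyContinuousOnInterval u 0 T)
    (h : ∀ᵐ t, t ∈ Set.Ioo 0 T →
      ∃ v, HasDerivAt u v t ∧ v ≤ -l * u t + a * Real.exp (-μ * t) + b) :
    ∀ t ∈ Set.Icc 0 T,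
      u t ≤ Real.exp (-l * t) * u 0 + 2 / l * a * Real.exp (-μ * t) + b / l := by
  intro t ht
  have hsub : Set.uIcc 0 t ⊆ Set.uIcc 0 T := by
    rw [Set.uIcc_of_le ht.1, Set.uIcc_of_le (ht.1.trans ht.2)]
    exact Set.Icc_subset_Icc_right ht.2
  have hac : ∀ {g : ℝ → ℝ}, ContDiff ℝ 1 g → AbsolutelyContinuousOnInterval g 0 t :=
    fun hg => hg.contDiffOn.absolutelyContinuousOnInterval
  refine comparison_le hl ha hb (AbsolutelyContinuousOnInterval.le_of_ae_deriv_nonpos ht.1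
    (u := fun s => Real.exp (l * s) * (u s - 2 / l * a * Real.exp (-μ * s) - b / l)) ?_ ?_)
  · refine (hac (by fun_prop)).fun_mul (((hu.mono hsub).fun_sub (hac ?_)).fun_sub (hac ?_)) <;>
      fun_prop
  · filter_upwards [h] with s hs hs'
    obtain ⟨v, hv, hv'⟩ := hs ⟨hs'.1, hs'.2.trans_le ht.2⟩
    exact comparison_hasDerivAt hl ha hμ hv hv'

/-- Comparison lemma for differentiable functions. -/
theorem comparison_of_hasDerivAt (hl : 0 < l) (hb : 0 ≤ b) {T : ℝ}
    (hu : ContinuousOn u (Set.Icc 0 T))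
    (h : ∀ t ∈ Set.Ioo 0 T, ∃ v, HasDerivAt u v t ∧ v ≤ -l * u t + b) :
    ∀ t ∈ Set.Icc 0 T, u t ≤ Real.exp (-l * t) * u 0 + b / l := by
  intro t ht
  have key : AntitoneOn
      (fun s => Real.exp (l * s) * (u s - 2 / l * 0 * Real.exp (-0 * s) - b / l))
      (Set.Icc 0 T) := by
    have hd : ∀ s ∈ interior (Set.Icc 0 T), ∃ v', HasDerivAt
        (fun s => Real.exp (l * s) * (u s - 2 / l * 0 * Real.exp (-0 * s) - b / l)) v' s ∧
          v' ≤ 0 := by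
      intro s hs
      rw [interior_Icc] at hs
      obtain ⟨v, hv, hv'⟩ := h s hs
      exact comparison_hasDerivAt hl le_rfl (by positivity) hv (by simpa using hv')
    refine antitoneOn_of_deriv_nonpos (convex_Icc _ _) ?_ ?_ ?_
    · fun_prop
    · intro s hs
      obtain ⟨v, hv, -⟩ := hd s hs
      exact hv.differentiableAt.differentiableWithinAt
    · intro s hs
      obtain ⟨v, hv, hv'⟩ := hd s hs
      rw [hv.deriv]; exact hv'
  simpa using comparison_le (μ := 0) hl le_rfl hb
    (key ⟨le_rfl, ht.1.trans ht.2⟩ ht ht.1)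

end Comparison

/-! ### Explicit comparison functions, smoothness and norm bounds. -/

theorem classKL_mul_exp {C k : ℝ} (hC : 0 < C) (hk : 0 < k) :
    ClassKL fun r s => C * r * Real.exp (-k * s) := by
  refine ⟨by fun_prop, fun s _ => ⟨by fun_prop, ?_, by simp⟩, fun r hr => ⟨?_, ?_⟩⟩
  · intro r _ r' _ h
    have := Real.exp_pos (-k * s)
    simp only
    gcongr
  · intro s _ s' _ h
    have : 0 ≤ r := hr
    simp only [neg_mul]
    gcongr
  · have : Filter.Tendsto (fun s => Real.exp (-(k * s))) Filter.atTop (𝓝 0) :=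
      Real.tendsto_exp_neg_atTop_nhds_zero.comp (Filter.tendsto_id.const_mul_atTop hk)
    simpa using this.const_mul (C * r)

theorem classK_mul {C : ℝ} (hC : 0 < C) : ClassK fun s => C * s := by
  refine ⟨by fun_prop, ?_, by simp⟩
  intro r _ r' _ h
  simp only
  gcongr

theorem contDiffOn_lieIter {n : ℕ} {f : Vec n → Vec n} {φ : Vec n → ℝ} {X : Set (Vec n)}
    (hX : IsOpen X) (hf : ContDiffOn ℝ ∞ f X) (hφ : ContDiffOn ℝ ∞ φ X) (k : ℕ) :
    ContDiffOn ℝ ∞ (lieIter f k φ) X := by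
  induction k with
  | zero => exact hφ
  | succ k ih =>
    rw [lieIter, Function.iterate_succ_apply']
    exact (ih.fderiv_of_isOpen hX (by simp)).clm_apply hf

theorem norm_le_sum_abs {ι : Type*} [Fintype ι] (v : EuclideanSpace ℝ ι) :
    ‖v‖ ≤ ∑ i, |v i| := by
  rw [EuclideanSpace.norm_eq]
  refine Real.sqrt_le_iff.2 ⟨Finset.sum_nonneg fun _ _ => abs_nonneg _, ?_⟩
  simpa using Finset.sum_sq_le_sq_sum_of_nonneg (s := Finset.univ) (f := fun i => |v i|)
    fun _ _ => abs_nonneg _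

/-- The form is homogeneous of degree two, so its extrema on the compact unit sphere suffice. -/
theorem Matrix.PosDef.exists_bounds {ι : Type*} [Fintype ι] {P : Matrix ι ι ℝ} (hP : P.PosDef) :
    ∃ p₁ p₂ : ℝ, 0 < p₁ ∧ 0 < p₂ ∧ ∀ z : EuclideanSpace ℝ ι,
      p₁ * ‖z‖ ^ 2 ≤ z.ofLp ⬝ᵥ P *ᵥ z.ofLp ∧ z.ofLp ⬝ᵥ P *ᵥ z.ofLp ≤ p₂ * ‖z‖ ^ 2 := by
  set q : EuclideanSpace ℝ ι → ℝ := fun z => z.ofLp ⬝ᵥ P *ᵥ z.ofLp with hq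
  have hc : Continuous q := by
    simp only [hq, dotProduct, Matrix.mulVec]
    fun_prop
  have hsm : ∀ (r : ℝ) z, q (r • z) = r ^ 2 * q z := by
    intro r z
    simp only [hq, WithLp.ofLp_smul, Matrix.mulVec_smul, smul_dotProduct, dotProduct_smul,
      smul_eq_mul]
    ring
  have hpos : ∀ z, z ≠ 0 → 0 < q z := by
    intro z hz
    have : z.ofLp ≠ 0 := by simpa using hz
    simpa using hP.dotProduct_mulVec_pos this
  have hK : IsCompact (Metric.sphere (0 : EuclideanSpace ℝ ι) 1) := isCompact_sphere _ _
  have h0 : q 0 = 0 := by simp [hq]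
  suffices ∃ p₁ p₂ : ℝ, 0 < p₁ ∧ 0 < p₂ ∧ ∀ z ∈ Metric.sphere (0 : EuclideanSpace ℝ ι) 1,
      p₁ ≤ q z ∧ q z ≤ p₂ by
    obtain ⟨p₁, p₂, h1, h2, h⟩ := this
    refine ⟨p₁, p₂, h1, h2, fun z => ?_⟩
    change p₁ * ‖z‖ ^ 2 ≤ q z ∧ q z ≤ p₂ * ‖z‖ ^ 2
    rcases eq_or_ne z 0 with rfl | hz
    · simp [h0]
    · have hn : ‖z‖ ≠ 0 := norm_ne_zero_iff.2 hz
      have hz' : z = ‖z‖ • (‖z‖⁻¹ • z) := by rw [smul_smul, mul_inv_cancel₀ hn, one_smul]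
      have := h (‖z‖⁻¹ • z) (by simp [norm_smul, hn])
      rw [hz', hsm, ← hz']
      constructor <;> nlinarith [sq_nonneg ‖z‖]
  rcases (Metric.sphere (0 : EuclideanSpace ℝ ι) 1).eq_empty_or_nonempty with he | hne
  -- The sphere is empty when the index type is.
  · exact ⟨1, 1, one_pos, one_pos, by simp [he]⟩
  · obtain ⟨a, ha, hmin⟩ := hK.exists_isMinOn hne hc.continuousOn
    obtain ⟨b, hb, hmax⟩ := hK.exists_isMaxOn hne hc.continuousOn
    have hne0 : ∀ v ∈ Metric.sphere (0 : EuclideanSpace ℝ ι) 1, v ≠ 0 := by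
      rintro _ hv rfl
      simp at hv
    exact ⟨q a, q b, hpos a (hne0 a ha), hpos b (hne0 b hb), fun z hz => ⟨hmin hz, hmax hz⟩⟩

theorem IsSignValue.norm_le_dotProduct {m : ℕ} {v s : Vec m} (h : IsSignValue v s) :
    ‖v‖ ≤ s.ofLp ⬝ᵥ v.ofLp := by
  refine (norm_le_sum_abs v).trans_eq (Finset.sum_congr rfl fun i _ => ?_)
  obtain ⟨h1, h2, -⟩ := h i
  rcases lt_trichotomy (v i) 0 with hv | hv | hv
  · rw [h2 hv, abs_of_neg hv]; ring
  · rw [hv]; simp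
  · rw [h1 hv, abs_of_pos hv]; ring

/-! ### Error dynamics and input-to-state stability. -/

namespace TrackingLoop

variable {n p m : ℕ} (S : TrackingLoop n p m)

/-- The input of the error dynamics `ż = Ã z + B̃ d`. -/
noncomputable def residual (t : ℝ) (x : Vec n) (est sgn : Vec m) : Vec m :=
  S.unc - ‖S.L (S.coord x)‖ ^ 2 • S.switching t x - (‖est‖ * ‖S.L (S.coord x)‖) • sgn

theorem matA_mulVec_of_lt (z : ((i : Fin m) × Fin (S.r i)) → ℝ) (i : Fin m) (k : Fin (S.r i))
    (hk : (k : ℕ) + 1 < S.r i) : (S.matA *ᵥ z) ⟨i, k⟩ = z ⟨i, ⟨k + 1, hk⟩⟩ := by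
  rw [matA, Matrix.mulVec, dotProduct, Fintype.sum_sigma, Finset.sum_eq_single i]
  · rw [Finset.sum_eq_single (⟨k + 1, hk⟩ : Fin (S.r i))]
    · simp [companion, hk.ne]
    · intro l _ hl
      have : (l : ℕ) ≠ k + 1 := fun h => hl (Fin.ext h)
      simp [companion, hk.ne, this]
    · simp
  · intro j _ hj
    simp [Matrix.blockDiagonal'_apply, hj.symm]
  · simp

theorem matA_mulVec_of_eq (z : ((i : Fin m) × Fin (S.r i)) → ℝ) (i : Fin m) (k : Fin (S.r i))
    (hk : (k : ℕ) + 1 = S.r i) : (S.matA *ᵥ z) ⟨i, k⟩ = -∑ l, S.gain i l * z ⟨i, l⟩ := by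
  rw [matA, Matrix.mulVec, dotProduct, Fintype.sum_sigma, Finset.sum_eq_single i]
  · simp [companion, hk]
  · intro j _ hj
    simp [Matrix.blockDiagonal'_apply, hj.symm]
  · simp

theorem matB_mulVec (d : Fin m → ℝ) (i : Fin m) (k : Fin (S.r i)) :
    (S.matB *ᵥ d) ⟨i, k⟩ = if (k : ℕ) + 1 = S.r i then d i else 0 := by
  rw [matB, Matrix.mulVec, dotProduct, Finset.sum_eq_single i]
  · by_cases h : (k : ℕ) + 1 = S.r i <;> simp [h]
  · intro j _ hj
    simp [hj]
  · simp

variable {S}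

theorem Admissible.contDiffOn_lieIter (hS : S.Admissible) (i : Fin m) (k : ℕ) :
    ContDiffOn ℝ ∞ (lieIter S.f k (S.h i)) S.X :=
  _root_.contDiffOn_lieIter hS.isOpen hS.smooth_f (hS.smooth_h i) k

/-- The closed-loop input acts through the decoupling matrix. -/
theorem Admissible.decoupling_mulVec_input (hS : S.Admissible) {x : Vec n} (hx : x ∈ S.X) (t : ℝ)
    (est sgn : Vec m) :
    S.decoupling x *ᵥ (S.nominalInput t x + S.robustInput t x est sgn).ofLp =
      (S.virtualInput t x).ofLp - (S.drift x).ofLp + (S.residual t x est sgn).ofLp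
        - S.unc.ofLp := by
  simp only [nominalInput, robustInput, residual, act, WithLp.ofLp_add, WithLp.ofLp_sub,
    WithLp.ofLp_neg, WithLp.ofLp_smul, Matrix.mulVec_add, Matrix.mulVec_sub, Matrix.mulVec_neg,
    Matrix.mulVec_smul, Matrix.mulVec_mulVec, hS.rinv_spec x hx, Matrix.one_mulVec]
  abel

/-- The linear error dynamics `ż = Ã z + B̃ d`. -/
theorem Admissible.fderiv_coord_sub (hS : S.Admissible) {x : Vec n} (hx : x ∈ S.X) (t : ℝ)
    (est sgn : Vec m) (q : (i : Fin m) × Fin (S.r i)) :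
    fderiv ℝ (lieIter S.f q.2 (S.h q.1)) x (S.closedLoopField t x est sgn)
        - iteratedDeriv (q.2 + 1) (S.yd q.1) t =
      (S.matA *ᵥ (S.err t x).ofLp + S.matB *ᵥ (S.residual t x est sgn).ofLp) q := by
  obtain ⟨i, k⟩ := q
  have hin := hS.decoupling_mulVec_input hx t est sgn
  set u := S.nominalInput t x + S.robustInput t x est sgn with hu
  have hfd : fderiv ℝ (lieIter S.f k (S.h i)) x (S.closedLoopField t x est sgn) =
      lieIter S.f (k + 1) (S.h i) x + lieD S.df (lieIter S.f k (S.h i)) x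
        + ∑ j, u j * lieD (S.g j) (lieIter S.f k (S.h i)) x := by
    rw [closedLoopField, map_add, map_add, map_sum, ← hu]
    simp only [map_smul, smul_eq_mul, lieD]
    congr 2
    rw [lieIter, lieIter, Function.iterate_succ_apply']
    rfl
  simp only [Pi.add_apply]
  rw [hfd, S.matB_mulVec]
  obtain ⟨-, hrel, -⟩ := hS.relDegree x hx
  obtain ⟨hm1, hm2⟩ := hS.matched.2 x hx i
  rcases (Nat.succ_le_of_lt k.2).lt_or_eq with hk | hk
  -- Below the top of a chain of integrators, relative degree removes the input and matching removes
  -- the uncertainty.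
  · rw [S.matA_mulVec_of_lt _ i k hk, hm1 k hk, if_neg hk.ne]
    have : ∀ j, lieD (S.g j) (lieIter S.f k (S.h i)) x = 0 := fun j =>
      (hrel i j k hk).self_of_nhds
    simp [this, err, coord]
  -- In the last row of a block the feedback cancels the drift and installs the gains.
  · have hk' : S.r i - 1 = k := by omega
    have hk2 : (k : ℕ) + 1 = S.r i := hk
    rw [S.matA_mulVec_of_eq _ i k hk2, if_pos hk2]
    rw [hk'] at hm2
    have h1 := congrFun hin i
    have h2 : (S.decoupling x *ᵥ u.ofLp) i =
        ∑ j, u j * lieD (S.g j) (lieIter S.f k (S.h i)) x := by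
      simp only [Matrix.mulVec, dotProduct, decoupling, Matrix.of_apply, hk', mul_comm]
    rw [hm2, ← h2, h1, hk2]
    simp only [virtualInput, drift, Pi.sub_apply, Pi.add_apply]
    ring

/-- The Lyapunov function `zᵀ P z`. -/
noncomputable def lyap (S : TrackingLoop n p m) (t : ℝ) (x : Vec n) : ℝ :=
  (S.err t x).ofLp ⬝ᵥ S.P *ᵥ (S.err t x).ofLp

/-- Joint smoothness in time and state makes `V` absolutely continuous along Filippov solutions. -/
theorem Admissible.contDiffOn_lyap (hS : S.Admissible) :
    ContDiffOn ℝ 1 (fun q : ℝ × Vec n => S.lyap q.1 q.2) (Set.univ ×ˢ S.X) := by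
  have h1 : ∀ q : (i : Fin m) × Fin (S.r i),
      ContDiffOn ℝ 1 (fun y : ℝ × Vec n => S.err y.1 y.2 q) (Set.univ ×ˢ S.X) := by
    intro q
    refine ContDiffOn.sub ?_ ?_
    · exact ((hS.contDiffOn_lieIter q.1 q.2).of_le (by simp)).comp contDiffOn_snd
        fun y hy => hy.2
    · have : ContDiff ℝ 1 (iteratedDeriv q.2 (S.yd q.1)) := by
        rw [iteratedDeriv_eq_iterate]
        exact ((hS.smooth_yd q.1).iterate_deriv q.2).of_le (by simp)
      exact (this.comp contDiff_fst).contDiffOn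
  simp only [lyap, dotProduct, Matrix.mulVec]
  exact ContDiffOn.sum fun q _ => (h1 q).mul
    (ContDiffOn.sum fun q' _ => contDiffOn_const.mul (h1 q'))

/-- The Lyapunov equation reduces the homogeneous part to `-‖z‖²`; by symmetry of `P` the input
contributes `2 d·(B̃ᵀPz)`, which is why the controller switches on `B̃ᵀPz`. -/
theorem Admissible.hasDerivAt_lyap (hS : S.Admissible) {x : ℝ → Vec n} {t : ℝ} {est sgn : Vec m}
    (hx : x t ∈ S.X) (hd : HasDerivAt x (S.closedLoopField t (x t) est sgn) t) :
    HasDerivAt (fun s => S.lyap s (x s))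
      (-‖S.err t (x t)‖ ^ 2
        + 2 * ((S.residual t (x t) est sgn).ofLp ⬝ᵥ (S.switching t (x t)).ofLp)) t := by
  set z := (S.err t (x t)).ofLp with hz
  set d := (S.residual t (x t) est sgn).ofLp with hd'
  set z' := S.matA *ᵥ z + S.matB *ᵥ d with hz'
  have h1 : ∀ q, HasDerivAt (fun s => S.err s (x s) q) (z' q) t := by
    intro q
    have e1 := ((hS.contDiffOn_lieIter q.1 q.2).contDiffAt
      (hS.isOpen.mem_nhds hx)).differentiableAt (by simp) |>.hasFDerivAt.comp_hasDerivAt t hd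
    have e2 : HasDerivAt (iteratedDeriv q.2 (S.yd q.1))
        (iteratedDeriv (q.2 + 1) (S.yd q.1) t) t := by
      rw [iteratedDeriv_succ]
      exact ((hS.smooth_yd q.1).differentiable_iteratedDeriv q.2
        (by exact_mod_cast WithTop.coe_lt_top _)).differentiableAt.hasDerivAt
    have e3 := e1.sub e2
    rw [hS.fderiv_coord_sub hx t est sgn q] at e3
    exact e3
  have h2 : HasDerivAt (fun s => S.lyap s (x s)) (z' ⬝ᵥ S.P *ᵥ z + z ⬝ᵥ S.P *ᵥ z') t := by
    simp only [lyap, dotProduct, Matrix.mulVec]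
    rw [← Finset.sum_add_distrib]
    exact HasDerivAt.fun_sum fun q _ => (h1 q).mul
      (HasDerivAt.fun_sum fun q' _ => (h1 q').const_mul (S.P q q'))
  convert h2 using 1
  have hsym : S.Pᵀ = S.P := by simpa using hS.posDef.isHermitian.eq
  have hn : ‖S.err t (x t)‖ ^ 2 = z ⬝ᵥ z := by
    rw [EuclideanSpace.norm_sq_eq]
    simp [dotProduct, hz, sq]
  have e0 : z ⬝ᵥ (S.matAᵀ * S.P + S.P * S.matA) *ᵥ z = -(z ⬝ᵥ z) := by
    rw [hS.lyapunov]; simp [Matrix.neg_mulVec]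
  have e1 : (S.matA *ᵥ z) ⬝ᵥ S.P *ᵥ z = z ⬝ᵥ (S.matAᵀ * S.P) *ᵥ z := by
    rw [← Matrix.mulVec_mulVec, Matrix.dotProduct_mulVec z, Matrix.vecMul_transpose]
  have e2 : (S.matB *ᵥ d) ⬝ᵥ S.P *ᵥ z = d ⬝ᵥ (S.switching t (x t)).ofLp := by
    rw [switching, act, ← hz]
    simp only
    rw [← Matrix.mulVec_mulVec, Matrix.dotProduct_mulVec d, Matrix.vecMul_transpose]
  have e3 : z ⬝ᵥ S.P *ᵥ z' = z' ⬝ᵥ S.P *ᵥ z := by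
    rw [Matrix.dotProduct_mulVec, ← Matrix.mulVec_transpose, hsym, dotProduct_comm]
  have e4 : (S.matA *ᵥ z) ⬝ᵥ S.P *ᵥ z = z ⬝ᵥ (S.P * S.matA) *ᵥ z := by
    rw [← Matrix.mulVec_mulVec, Matrix.dotProduct_mulVec z, ← Matrix.mulVec_transpose, hsym,
      dotProduct_comm]
  rw [e3, hz', add_dotProduct, e2, hn, ← neg_eq_iff_eq_neg.2 e0, Matrix.add_mulVec,
    dotProduct_add, ← e1, ← e4]
  ring

/-- The robustifying terms dominate the uncertainty up to the estimation error. -/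
theorem Admissible.residual_dotProduct_le (hS : S.Admissible) {x : Vec n} (hx : x ∈ S.X) {t : ℝ}
    {est sgn : Vec m} (hs : IsSignValue (S.switching t x) sgn) {q : ℝ}
    (hest : ‖S.unc‖ - ‖est‖ ≤ q) :
    2 * ((S.residual t x est sgn).ofLp ⬝ᵥ (S.switching t x).ofLp) ≤ q ^ 2 / 2 := by
  set w := S.switching t x with hw
  set ℓ := ‖S.L (S.coord x)‖ with hℓ
  have hℓ0 : 0 ≤ ℓ := norm_nonneg _
  have h1 : (S.residual t x est sgn).ofLp ⬝ᵥ w.ofLp =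
      S.unc.ofLp ⬝ᵥ w.ofLp - ℓ ^ 2 * ‖w‖ ^ 2 - ‖est‖ * ℓ * (sgn.ofLp ⬝ᵥ w.ofLp) := by
    have hn : ‖w‖ ^ 2 = w.ofLp ⬝ᵥ w.ofLp := by
      rw [EuclideanSpace.norm_sq_eq]
      simp [dotProduct, sq]
    simp only [hn, residual, ← hw, ← hℓ, WithLp.ofLp_sub, WithLp.ofLp_smul, sub_dotProduct,
      smul_dotProduct, smul_eq_mul]
  have h2 : S.unc.ofLp ⬝ᵥ w.ofLp ≤ ‖S.unc‖ * ‖w‖ := by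
    have := real_inner_le_norm w S.unc
    rw [EuclideanSpace.inner_eq_star_dotProduct] at this
    simp only [star_trivial] at this
    linarith
  have h3 : ‖S.unc‖ * ‖w‖ ≤ ‖S.unc‖ * ℓ * ‖w‖ :=
    mul_le_mul_of_nonneg_right (hS.unc_bound x hx) (norm_nonneg _)
  have h4 : ‖est‖ * ℓ * ‖w‖ ≤ ‖est‖ * ℓ * (sgn.ofLp ⬝ᵥ w.ofLp) :=
    mul_le_mul_of_nonneg_left hs.norm_le_dotProduct (by positivity)
  have h5 : (‖S.unc‖ - ‖est‖) * (ℓ * ‖w‖) ≤ q * (ℓ * ‖w‖) :=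
    mul_le_mul_of_nonneg_right hest (by positivity)
  rw [h1]
  -- What remains is `2qs - 2s² ≤ q²/2` with `s = ℓ‖w‖`: the damping `ℓ²‖w‖²` absorbs the linear
  -- term.
  nlinarith [sq_nonneg (q - 2 * (ℓ * ‖w‖))]

/-- Input-to-state stability of the tracking error with respect to the part of the uncertainty that
the robust controller does not compensate. -/
theorem Admissible.exists_iss (hS : S.Admissible) :
    ∃ C₀ C₁ k : ℝ, 0 < C₀ ∧ 0 < C₁ ∧ 0 < k ∧
      ∀ (J : Vec m → ℝ) (a w : Fin m → ℝ) (T : ℝ) (x : ℝ → Vec n) (sgn η : ℝ → Vec m), 0 < T →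
        IsClosedLoopSolution S J a w T x sgn η → ∀ A B μ : ℝ, 0 ≤ A → 0 ≤ B → μ ≤ k →
          (∀ t ∈ Set.Icc 0 T,
            ‖S.unc‖ - ‖estimate a w η t‖ ≤ A * Real.exp (-μ * t) + B) →
          ∀ t ∈ Set.Icc 0 T, ‖S.err t (x t)‖ ≤
            C₀ * ‖S.err 0 (x 0)‖ * Real.exp (-k * t) + C₁ * (A * Real.exp (-μ * t) + B) := by
  obtain ⟨p₁, p₂, hp₁, hp₂, hP⟩ := hS.posDef.exists_bounds
  refine ⟨√(p₂ / p₁), √(2 * p₂ / p₁), 1 / (4 * p₂), by positivity, by positivity, by positivity,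
    ?_⟩
  intro J a w T x sgn η hT hsol A B μ hA hB hμ hest t ht
  have hu : Set.uIcc 0 T = Set.Icc 0 T := Set.uIcc_of_le hT.le
  have hac : AbsolutelyContinuousOnInterval (fun s => S.lyap s (x s)) 0 T :=
    (absolutelyContinuousOnInterval_graph hT.le hsol.integrable hsol.state).comp_contDiffOn
      (isOpen_univ.prod hS.isOpen) hS.contDiffOn_lyap
      (fun s hs => ⟨trivial, hsol.mem s (hu ▸ hs)⟩)
  -- `V' ≤ -V/p₂ + A²e^{-2μt} + B²`. The comparison lemma needs `2μ ≤ 1/(2p₂)`, whence the rate `k =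
  -- 1/(4p₂)`.
  have key := hac.comparison (l := 1 / p₂) (a := A ^ 2) (b := B ^ 2) (μ := 2 * μ) (by positivity)
    (by positivity) (by positivity)
    (by
      have : 2 * (1 / (4 * p₂)) = 1 / p₂ / 2 := by field_simp; norm_num
      linarith) ?_ t ht
  · set E := Real.exp (-μ * t) with hE
    have hE0 : 0 < E := Real.exp_pos _
    have hE2 : Real.exp (-(2 * μ) * t) = E ^ 2 := by
      rw [hE, ← Real.exp_nat_mul]; congr 1; push_cast; ring
    set E' := Real.exp (-(1 / (4 * p₂)) * t) with hE'
    have hE'0 : 0 < E' := Real.exp_pos _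
    have hE'2 : Real.exp (-(1 / p₂) * t) ≤ E' ^ 2 := by
      rw [hE', ← Real.exp_nat_mul]
      refine Real.exp_le_exp.2 ?_
      have : 0 ≤ 1 / p₂ * t := mul_nonneg (by positivity) ht.1
      have e : ((2 : ℕ) : ℝ) * (-(1 / (4 * p₂)) * t) = -(1 / p₂ * t) / 2 := by
        push_cast; field_simp; norm_num
      rw [e]; linarith
    rw [hE2] at key
    have h1 := (hP (S.err t (x t))).1
    have h2 := (hP (S.err 0 (x 0))).2
    set z := ‖S.err t (x t)‖ with hz
    set z0 := ‖S.err 0 (x 0)‖ with hz0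
    have hz00 : 0 ≤ z0 := norm_nonneg _
    have h3 : p₁ * z ^ 2 ≤ p₂ * (E' * z0) ^ 2 + 2 * p₂ * (A * E + B) ^ 2 := by
      have e1 : Real.exp (-(1 / p₂) * t) * S.lyap 0 (x 0) ≤ E' ^ 2 * (p₂ * z0 ^ 2) :=
        mul_le_mul hE'2 h2 ((by positivity : (0 : ℝ) ≤ p₁ * z0 ^ 2).trans (hP _).1) (by positivity)
      have e2 : 2 / (1 / p₂) * A ^ 2 * E ^ 2 + B ^ 2 / (1 / p₂) ≤ 2 * p₂ * (A * E + B) ^ 2 := by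
        have : 2 / (1 / p₂) * A ^ 2 * E ^ 2 + B ^ 2 / (1 / p₂)
            = p₂ * (2 * (A * E) ^ 2 + B ^ 2) := by field_simp
        rw [this, mul_comm 2 p₂, mul_assoc]
        refine mul_le_mul_of_nonneg_left ?_ hp₂.le
        have : 0 ≤ A * E * B := by positivity
        nlinarith [sq_nonneg B]
      change p₁ * z ^ 2 ≤ S.lyap t (x t) at h1
      linarith
    refine le_of_sq_le_sq ?_ (by positivity)
    have s1 : √(p₂ / p₁) ^ 2 = p₂ / p₁ := Real.sq_sqrt (by positivity)
    have s2 : √(2 * p₂ / p₁) ^ 2 = 2 * p₂ / p₁ := Real.sq_sqrt (by positivity)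
    have h4 : z ^ 2 ≤ p₂ / p₁ * (E' * z0) ^ 2 + 2 * p₂ / p₁ * (A * E + B) ^ 2 := by
      rw [← mul_le_mul_iff_right₀ hp₁]
      refine h3.trans_eq ?_
      field_simp
    rw [← s1, ← s2] at h4
    have : 0 ≤ √(p₂ / p₁) * z0 * E' * (√(2 * p₂ / p₁) * (A * E + B)) := by positivity
    nlinarith
  · filter_upwards [ae_hasDerivAt_of_eq_integral hT.le hsol.integrable hsol.state] with s hs hmem
    have hs' := Set.Ioo_subset_Icc_self hmem
    refine ⟨_, hS.hasDerivAt_lyap (hsol.mem s hs') (hs hmem), ?_⟩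
    have h1 := hS.residual_dotProduct_le (hsol.mem s hs') (hsol.sign s hs')
      (hest s hs')
    have h2 : S.lyap s (x s) ≤ p₂ * ‖S.err s (x s)‖ ^ 2 := (hP _).2
    have h3 : 1 / p₂ * S.lyap s (x s) ≤ ‖S.err s (x s)‖ ^ 2 := by
      rw [one_div, inv_mul_le_iff₀ hp₂]; exact h2
    have h4 : Real.exp (-(2 * μ) * s) = Real.exp (-μ * s) ^ 2 := by
      rw [← Real.exp_nat_mul]; congr 1; push_cast; ring
    rw [h4]
    -- Here `(A e^{-μs} + B)²/2 ≤ A² e^{-2μs} + B²`.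
    nlinarith [sq_nonneg (A * Real.exp (-μ * s) - B)]

end TrackingLoop

/-! ### Oscillations of mean zero. -/

/-- `p` has mean zero, in the strong sense that it has a bounded primitive. -/
def HasBoundedPrimitive (p : ℝ → ℝ) : Prop :=
  ∃ (q : ℝ → ℝ) (K : ℝ), (∀ s, HasDerivAt q (p s) s) ∧ ∀ s, |q s| ≤ K

namespace HasBoundedPrimitive

theorem cos_mul {a : ℝ} (ha : a ≠ 0) : HasBoundedPrimitive fun s => Real.cos (a * s) := by
  refine ⟨fun s => Real.sin (a * s) / a, 1 / |a|, fun s => ?_, fun s => ?_⟩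
  · have := (((hasDerivAt_id s).const_mul a).sin).div_const a
    have e : Real.cos (a * s) = Real.cos (a * s) * (a * 1) / a := by field_simp
    exact this.congr_deriv e.symm
  · rw [abs_div]
    gcongr
    exact Real.abs_sin_le_one _

theorem add {p q : ℝ → ℝ} (hp : HasBoundedPrimitive p) (hq : HasBoundedPrimitive q) :
    HasBoundedPrimitive fun s => p s + q s := by
  obtain ⟨P, K, hP, hK⟩ := hp
  obtain ⟨Q, K', hQ, hK'⟩ := hq
  exact ⟨fun s => P s + Q s, K + K', fun s => (hP s).add (hQ s),
    fun s => (abs_add_le _ _).trans (add_le_add (hK s) (hK' s))⟩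

theorem const_mul {p : ℝ → ℝ} (r : ℝ) (hp : HasBoundedPrimitive p) :
    HasBoundedPrimitive fun s => r * p s := by
  obtain ⟨P, K, hP, hK⟩ := hp
  refine ⟨fun s => r * P s, |r| * K, fun s => (hP s).const_mul r, fun s => ?_⟩
  rw [abs_mul]
  gcongr
  exact hK s

theorem zero : HasBoundedPrimitive fun _ => 0 :=
  ⟨fun _ => 0, 0, fun s => hasDerivAt_const s 0, by simp⟩

end HasBoundedPrimitive

section Trig

variable {m : ℕ} {w : Fin m → ℝ}

/-- Product-to-sum: the difference frequency vanishes only on the diagonal, where it leaves the mean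
`1/2`. -/
theorem NonResonant.cos_mul_cos (hw : NonResonant w) (hpos : ∀ i, 0 < w i) (i j : Fin m) :
    HasBoundedPrimitive fun s =>
      Real.cos (w i * s) * Real.cos (w j * s) - if i = j then 1 / 2 else 0 := by
  have h1 : HasBoundedPrimitive fun s => Real.cos ((w i + w j) * s) :=
    .cos_mul (add_pos (hpos i) (hpos j)).ne'
  have h2 : HasBoundedPrimitive fun s =>
      Real.cos ((w i - w j) * s) - if i = j then 1 else 0 := by
    by_cases h : i = j
    · simpa [h] using HasBoundedPrimitive.zero
    · simpa [h] using HasBoundedPrimitive.cos_mul (sub_ne_zero.2 (hw.1 i j h))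
  convert (h1.add h2).const_mul (1 / 2) using 2 with s
  rw [add_mul, sub_mul, Real.cos_add, Real.cos_sub]
  split_ifs <;> ring

/-- Expanding into four cosines produces the frequencies `w i + w j - w k` and their permutations;
the condition that no frequency is a sum of two serves to keep them nonzero. -/
theorem NonResonant.cos_mul_cos_mul_cos (hw : NonResonant w) (hpos : ∀ i, 0 < w i)
    (i j k : Fin m) :
    HasBoundedPrimitive fun s =>
      Real.cos (w i * s) * Real.cos (w j * s) * Real.cos (w k * s) := by
  have h1 : HasBoundedPrimitive fun s => Real.cos ((w i + w j + w k) * s) :=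
    .cos_mul (add_pos (add_pos (hpos i) (hpos j)) (hpos k)).ne'
  have h2 : HasBoundedPrimitive fun s => Real.cos ((w i + w j - w k) * s) :=
    .cos_mul (sub_ne_zero.2 (hw.2 i j k))
  have h3 : HasBoundedPrimitive fun s => Real.cos ((w i + w k - w j) * s) :=
    .cos_mul (sub_ne_zero.2 (hw.2 i k j))
  have h4 : HasBoundedPrimitive fun s => Real.cos ((w j + w k - w i) * s) :=
    .cos_mul (sub_ne_zero.2 (hw.2 j k i))
  convert ((h1.add h2).add (h3.add h4)).const_mul (1 / 4) using 2 with s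
  simp only [add_mul, sub_mul, Real.cos_add, Real.cos_sub, Real.sin_add]
  ring

end Trig

/-! ### Averaging of a scalar differential inequality. -/

section Averaging

variable {E : Type*} [NormedAddCommGroup E] [NormedSpace ℝ E] [ProperSpace E]

/-- Averaging for scalar differential inequalities: mean-zero oscillations of frequency `κ` change
the comparison estimate by `O(1 / κ)` only. -/
theorem exists_averaging_bound {ι : Type*} [Fintype ι] {p : ι → ℝ → ℝ}
    (hp : ∀ α, HasBoundedPrimitive (p α)) {ψ : ι → E → ℝ} {R : ℝ}
    (hψ : ∀ α, ∀ y ∈ Metric.closedBall (0 : E) R, ContDiffAt ℝ 1 (ψ α) y) {l b v : ℝ}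
    (hl : 0 < l) (hb : 0 ≤ b) (hv : 0 ≤ v) :
    ∃ C : ℝ, 0 ≤ C ∧ ∀ κ : ℝ, 0 < κ → ∀ (T : ℝ) (y y' : ℝ → E) (W W' : ℝ → ℝ),
      (∀ t ∈ Set.Icc 0 T, y t ∈ Metric.closedBall (0 : E) R) → ContinuousOn y (Set.Icc 0 T) →
      (∀ t ∈ Set.Ioo 0 T, HasDerivAt y (y' t) t ∧ ‖y' t‖ ≤ v) → ContinuousOn W (Set.Icc 0 T) →
      (∀ t ∈ Set.Ioo 0 T, HasDerivAt W (W' t) t ∧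
        W' t ≤ -l * W t + b + ∑ α, p α (κ * t) * ψ α (y t)) →
      ∀ t ∈ Set.Icc 0 T, W t ≤ Real.exp (-l * t) * W 0 + b / l + C / κ := by
  choose q K hq hK using hp
  have hK0 : ∀ α, 0 ≤ K α := fun α => (abs_nonneg _).trans (hK α 0)
  have hcomp : IsCompact (Metric.closedBall (0 : E) R) := isCompact_closedBall _ _
  have hM1 : ∀ α, ∃ M, ∀ y ∈ Metric.closedBall (0 : E) R, ‖ψ α y‖ ≤ M := fun α =>
    hcomp.exists_bound_of_continuousOn fun y hy => (hψ α y hy).continuousAt.continuousWithinAt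
  have hM2 : ∀ α, ∃ M, ∀ y ∈ Metric.closedBall (0 : E) R, ‖fderiv ℝ (ψ α) y‖ ≤ M := fun α =>
    hcomp.exists_bound_of_continuousOn fun y hy =>
      ((hψ α y hy).fderiv_right (m := 0) (by simp)).continuousAt.continuousWithinAt
  choose M₁ hM₁ using hM1
  choose M₂ hM₂ using hM2
  set K₁ := ∑ α, K α * |M₁ α| with hK₁
  set K₂ := ∑ α, K α * (|M₂ α| * v) with hK₂
  have hK₁0 : 0 ≤ K₁ := Finset.sum_nonneg fun α _ => mul_nonneg (hK0 α) (abs_nonneg _)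
  have hK₂0 : 0 ≤ K₂ := Finset.sum_nonneg fun α _ =>
    mul_nonneg (hK0 α) (mul_nonneg (abs_nonneg _) hv)
  -- The corrector costs `K₁` at each of the two endpoints, and its drift forces the comparison with
  -- `(K₂ + l K₁)/κ`.
  refine ⟨2 * K₁ + (K₂ + l * K₁) / l, by positivity, ?_⟩
  intro κ hκ T y y' W W' hyR hyc hy hWc hW t ht
  -- In the derivative of `N / κ`, the fast factors reproduce the oscillating sum exactly; the slow
  -- motion of `y` leaves only `O(1/κ)`.
  set N : ℝ → ℝ := fun s => ∑ α, q α (κ * s) * ψ α (y s) with hN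
  have hNb : ∀ s ∈ Set.Icc 0 T, |N s| ≤ K₁ := fun s hs => by
    refine (Finset.abs_sum_le_sum_abs _ _).trans (Finset.sum_le_sum fun α _ => ?_)
    rw [abs_mul]
    exact mul_le_mul (hK α _) ((hM₁ α _ (hyR s hs)).trans (le_abs_self _)) (abs_nonneg _) (hK0 α)
  have hNd : ∀ s ∈ Set.Ioo 0 T, HasDerivAt N
      (κ * (∑ α, p α (κ * s) * ψ α (y s)) + ∑ α, q α (κ * s) * fderiv ℝ (ψ α) (y s) (y' s)) s := by
    intro s hs
    have h1 : ∀ α, HasDerivAt (fun s => q α (κ * s) * ψ α (y s))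
        (κ * (p α (κ * s) * ψ α (y s)) + q α (κ * s) * fderiv ℝ (ψ α) (y s) (y' s)) s := by
      intro α
      have e1 : HasDerivAt (fun s => q α (κ * s)) (p α (κ * s) * (κ * 1)) s :=
        (hq α (κ * s)).comp s ((hasDerivAt_id s).const_mul κ)
      have e2 : HasDerivAt (fun s => ψ α (y s)) (fderiv ℝ (ψ α) (y s) (y' s)) s :=
        ((hψ α _ (hyR s (Set.Ioo_subset_Icc_self hs))).differentiableAt
          (by simp)).hasFDerivAt.comp_hasDerivAt s (hy s hs).1
      exact (e1.mul e2).congr_deriv (by ring)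
    rw [Finset.mul_sum, ← Finset.sum_add_distrib]
    exact HasDerivAt.fun_sum fun α _ => h1 α
  have hNc : ContinuousOn N (Set.Icc 0 T) := by
    refine continuousOn_finsetSum _ fun α _ => ?_
    have hqc : Continuous (q α) := continuous_iff_continuousAt.2 fun s => (hq α s).continuousAt
    refine (hqc.comp (continuous_const.mul continuous_id)).continuousOn.mul ?_
    intro s hs
    exact (hψ α _ (hyR s hs)).continuousAt.comp_continuousWithinAt (hyc s hs)
  have key := comparison_of_hasDerivAt (u := fun s => W s - N s / κ) (b := b + (K₂ + l * K₁) / κ)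
    hl (by positivity) (hWc.sub (hNc.div_const κ)) (fun s hs => ?_) t ht
  · have h0 := abs_le.1 (hNb 0 ⟨le_rfl, ht.1.trans ht.2⟩)
    have h1 := abs_le.1 (hNb t ht)
    have hE0 : 0 < Real.exp (-l * t) := Real.exp_pos _
    have hE1 : Real.exp (-l * t) ≤ 1 := Real.exp_le_one_iff.2 (by nlinarith [ht.1])
    have h2 : N t / κ ≤ K₁ / κ := by gcongr; exact h1.2
    have h3 : -(N 0 / κ) ≤ K₁ / κ := by rw [← neg_div]; gcongr; linarith [h0.1]
    have h4 : Real.exp (-l * t) * -(N 0 / κ) ≤ K₁ / κ := by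
      have : 0 ≤ K₁ / κ := by positivity
      nlinarith
    have h5 : (2 * K₁ + (K₂ + l * K₁) / l) / κ = K₁ / κ + K₁ / κ + (K₂ + l * K₁) / κ / l := by
      field_simp; ring
    rw [h5]
    simp only [add_div b, mul_sub] at key
    linarith
  · refine ⟨_, (hW s hs).1.sub ((hNd s hs).div_const κ), ?_⟩
    have hs' := Set.Ioo_subset_Icc_self hs
    have h1 : |∑ α, q α (κ * s) * fderiv ℝ (ψ α) (y s) (y' s)| ≤ K₂ := by
      refine (Finset.abs_sum_le_sum_abs _ _).trans (Finset.sum_le_sum fun α _ => ?_)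
      rw [abs_mul]
      refine mul_le_mul (hK α _) ?_ (abs_nonneg _) (hK0 α)
      refine ((fderiv ℝ (ψ α) (y s)).le_opNorm (y' s)).trans ?_
      exact mul_le_mul ((hM₂ α _ (hyR s hs')).trans (le_abs_self _)) (hy s hs).2 (norm_nonneg _)
        (abs_nonneg _)
    have h2 : -(∑ α, q α (κ * s) * fderiv ℝ (ψ α) (y s) (y' s)) / κ ≤ K₂ / κ := by
      gcongr; exact (neg_le_abs _).trans h1
    have h3 : -N s / κ ≤ K₁ / κ := by gcongr; exact (neg_le_abs _).trans (hNb s hs')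
    have h4 := (hW s hs).2
    have h5 : l * (-N s / κ) ≤ l * (K₁ / κ) := mul_le_mul_of_nonneg_left h3 hl.le
    rw [add_div, mul_div_cancel_left₀ _ hκ.ne', add_div K₂, mul_div_assoc l]
    rw [neg_div] at h2 h5
    linarith

end Averaging

/-! ### Second-order expansion at the minimum. -/

section Taylor

variable {E : Type*} [NormedAddCommGroup E] [NormedSpace ℝ E]

/-- Second-order Taylor expansion with the Hessian frozen at the origin. -/
theorem ContDiffAt.exists_taylor_frozen {G : E → ℝ} (hG : ContDiffAt ℝ 2 G 0) {δ : ℝ}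
    (hδ : 0 < δ) : ∃ R : ℝ, 0 < R ∧ (∀ y ∈ Metric.closedBall (0 : E) R, ContDiffAt ℝ 2 G y) ∧
      (∀ y ∈ Metric.closedBall (0 : E) R, ∀ z ∈ Metric.closedBall (0 : E) R,
        |G z - (G y + fderiv ℝ G y (z - y)
          + 1 / 2 * fderiv ℝ (fderiv ℝ G) 0 (z - y) (z - y))| ≤ δ * ‖z - y‖ ^ 2) ∧
      ∀ y ∈ Metric.closedBall (0 : E) R,
        ‖fderiv ℝ G y - fderiv ℝ G 0 - fderiv ℝ (fderiv ℝ G) 0 y‖ ≤ δ * ‖y‖ := by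
  set H := fderiv ℝ (fderiv ℝ G) 0 with hH
  have hsym : ∀ u v, H u v = H v u := fun u v =>
    (hG.isSymmSndFDerivAt (by simp)).eq u v
  have h1 : ∀ᶠ y in 𝓝 (0 : E), ContDiffAt ℝ 2 G y := hG.eventually (by simp)
  have hD1 : ∀ y, ContDiffAt ℝ 2 G y → ContDiffAt ℝ 1 (fderiv ℝ G) y := fun y hy =>
    hy.fderiv_right (by norm_num)
  have h2 : ∀ᶠ y in 𝓝 (0 : E), ‖fderiv ℝ (fderiv ℝ G) y - H‖ < δ := by
    have hc : ContinuousAt (fderiv ℝ (fderiv ℝ G)) 0 :=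
      ((hD1 0 hG).fderiv_right (m := 0) (by simp)).continuousAt
    have hc' : ContinuousAt (fun y => ‖fderiv ℝ (fderiv ℝ G) y - H‖) 0 :=
      ContinuousAt.norm (E := E →L[ℝ] E →L[ℝ] ℝ) (hc.sub continuousAt_const)
    exact hc'.eventually_lt continuousAt_const (by
      change ‖H - H‖ < δ
      rw [sub_self]
      exact (norm_zero (E := E →L[ℝ] E →L[ℝ] ℝ)).trans_lt hδ)
  obtain ⟨R, hR, hball⟩ := Metric.nhds_basis_closedBall.eventually_iff.1 (h1.and h2)
  have hconv : Convex ℝ (Metric.closedBall (0 : E) R) := convex_closedBall _ _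
  -- The map `G' - H` has derivative smaller than `δ` on the ball, so the mean value inequality
  -- applies; a second use, along the segment, gives the expansion of `G`.
  have hgrad : ∀ y ∈ Metric.closedBall (0 : E) R, ∀ z ∈ Metric.closedBall (0 : E) R,
      ‖fderiv ℝ G z - fderiv ℝ G y - H (z - y)‖ ≤ δ * ‖z - y‖ := by
    intro y hy z hz
    have := hconv.norm_image_sub_le_of_norm_hasFDerivWithin_le
      (f := fun x => fderiv ℝ G x - H x) (f' := fun x => fderiv ℝ (fderiv ℝ G) x - H) (C := δ)
      (fun x hx => ((((hD1 x (hball hx).1).differentiableAt (by simp)).hasFDerivAt).sub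
        H.hasFDerivAt).hasFDerivWithinAt) (fun x hx => (hball hx).2.le) hy hz
    rwa [sub_sub_sub_comm, ← map_sub] at this
  refine ⟨R, hR, fun y hy => (hball hy).1, fun y hy z hz => ?_, fun y hy => ?_⟩
  · have hseg : segment ℝ y z ⊆ Metric.closedBall (0 : E) R := hconv.segment_subset hy hz
    have := (convex_segment y z).norm_image_sub_le_of_norm_hasFDerivWithin_le
      (f := fun x => G x - (fderiv ℝ G y (x - y) + 1 / 2 * H (x - y) (x - y)))
      (f' := fun x => fderiv ℝ G x - fderiv ℝ G y - H (x - y)) (C := δ * ‖z - y‖)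
      (fun x hx => ?_) (fun x hx => ?_) (left_mem_segment ℝ y z) (right_mem_segment ℝ y z)
    · rw [Real.norm_eq_abs] at this
      simp only [sub_self, map_zero, mul_zero, add_zero, sub_zero] at this
      rw [sq, ← mul_assoc]
      convert this using 2
      ring
    · have e0 : HasFDerivAt (fun x : E => x - y) (ContinuousLinearMap.id ℝ E) x :=
        (hasFDerivAt_id x).sub_const y
      have e1 := (((hball (hseg hx)).1.differentiableAt (by simp)).hasFDerivAt).sub
        (((fderiv ℝ G y).hasFDerivAt.comp x e0).add
          (((H.hasFDerivAt.comp x e0).clm_apply e0).const_mul (1 / 2 : ℝ)))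
      refine HasFDerivAt.hasFDerivWithinAt (e1.congr_fderiv ?_)
      ext v
      simp
      linear_combination (1 / 2) * hsym x v - (1 / 2) * hsym y v
    · refine (hgrad y hy x (hseg hx)).trans ?_
      gcongr
      exact norm_sub_le_of_mem_segment hx
  · simpa using hgrad 0 (by simpa using hR.le) y hy

/-- Quadratic growth at a critical point makes the gradient strongly monotone towards it. -/
theorem ContDiffAt.exists_taylor_of_growth {G : E → ℝ} (hG : ContDiffAt ℝ 2 G 0)
    (h0 : fderiv ℝ G 0 = 0) {c δ : ℝ} (hgrow : ∀ᶠ y in 𝓝 (0 : E), G 0 + c * ‖y‖ ^ 2 ≤ G y)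
    (hδ : 0 < δ) (hδc : 3 * δ ≤ c) :
    ∃ R : ℝ, 0 < R ∧ (∀ y ∈ Metric.closedBall (0 : E) R, ContDiffAt ℝ 2 G y) ∧
      (∀ y ∈ Metric.closedBall (0 : E) R, ∀ z ∈ Metric.closedBall (0 : E) R,
        |G z - (G y + fderiv ℝ G y (z - y)
          + 1 / 2 * fderiv ℝ (fderiv ℝ G) 0 (z - y) (z - y))| ≤ δ * ‖z - y‖ ^ 2) ∧
      ∀ y ∈ Metric.closedBall (0 : E) R, c * ‖y‖ ^ 2 ≤ fderiv ℝ G y y := by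
  obtain ⟨R₁, hR₁, hcd, htay, hgrad⟩ := hG.exists_taylor_frozen hδ
  obtain ⟨R₂, hR₂, hball⟩ := Metric.nhds_basis_closedBall.eventually_iff.1 hgrow
  have hs1 : Metric.closedBall (0 : E) (min R₁ R₂) ⊆ Metric.closedBall 0 R₁ :=
    Metric.closedBall_subset_closedBall (min_le_left _ _)
  have hs2 : Metric.closedBall (0 : E) (min R₁ R₂) ⊆ Metric.closedBall 0 R₂ :=
    Metric.closedBall_subset_closedBall (min_le_right _ _)
  refine ⟨min R₁ R₂, lt_min hR₁ hR₂, fun y hy => hcd y (hs1 hy),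
    fun y hy z hz => htay y (hs1 hy) z (hs1 hz), fun y hy => ?_⟩
  have h1 := (abs_le.1 (htay 0 (by simpa using hR₁.le) y (hs1 hy))).2
  have h2 := hball (hs2 hy)
  have h3 := hgrad y (hs1 hy)
  set H := fderiv ℝ (fderiv ℝ G) 0
  rw [h0, sub_zero] at h3
  have h4 : |fderiv ℝ G y y - H y y| ≤ δ * ‖y‖ * ‖y‖ :=
    ((fderiv ℝ G y - H y).le_opNorm y).trans
      (mul_le_mul_of_nonneg_right h3 (norm_nonneg _))
  have h5 := (abs_le.1 h4).1
  rw [h0] at h1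
  simp only [sub_zero, zero_apply, add_zero] at h1
  -- Growth and Taylor give `H(y,y) ≥ 2(c - δ)‖y‖²`, so `G'(y)y ≥ (2c - 3δ)‖y‖² ≥ c‖y‖²`.
  nlinarith [sq_nonneg ‖y‖]

end Taylor

/-! ### Dither signals and the oscillating terms. -/

/-- The vector of dither signals. -/
noncomputable def cosVec {m : ℕ} (w : Fin m → ℝ) (s : ℝ) : Vec m :=
  WithLp.toLp 2 fun i => Real.cos (w i * s)

section Dither

variable {m : ℕ}

theorem norm_cosVec_le (w : Fin m → ℝ) (s : ℝ) : ‖cosVec w s‖ ≤ √m := by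
  rw [EuclideanSpace.norm_eq]
  refine Real.sqrt_le_sqrt ((Finset.sum_le_sum fun i _ => ?_).trans_eq (by simp :
    ∑ _i : Fin m, (1 : ℝ) = m))
  rw [Real.norm_eq_abs, sq_abs]
  exact Real.cos_sq_le_one _

theorem Vec.eq_sum_single (v : Vec m) : v = ∑ i, v i • EuclideanSpace.single i (1 : ℝ) := by
  ext j
  simp [Finset.sum_apply, Pi.single_apply]

theorem Vec.clm_apply_eq_sum (D : Vec m →L[ℝ] ℝ) (v : Vec m) :
    D v = ∑ i, v i * D (EuclideanSpace.single i 1) := by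
  conv_lhs => rw [Vec.eq_sum_single v]
  simp

/-- The amplitudes of the oscillating terms in the derivative of `‖y‖²`. -/
noncomputable def ditherAmplitude (G : Vec m → ℝ) (ε : ℝ) :
    Fin m ⊕ (Fin m × Fin m) ⊕ (Fin m × Fin m × Fin m) → Vec m → ℝ
  | .inl i => fun y => 2 * ε * (y i * G y)
  | .inr (.inl (i, j)) => fun y =>
      -2 * ε ^ 2 * (y i * fderiv ℝ G y (EuclideanSpace.single j 1))
  | .inr (.inr (i, j, k)) => fun y =>
      ε ^ 3 * (y i * fderiv ℝ (fderiv ℝ G) 0 (EuclideanSpace.single j 1)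
        (EuclideanSpace.single k 1))

/-- The oscillating factors in the derivative of `‖y‖²`. -/
noncomputable def ditherOscillation (w : Fin m → ℝ) :
    Fin m ⊕ (Fin m × Fin m) ⊕ (Fin m × Fin m × Fin m) → ℝ → ℝ
  | .inl i => fun s => Real.cos (w i * s)
  | .inr (.inl (i, j)) => fun s =>
      Real.cos (w i * s) * Real.cos (w j * s) - if i = j then 1 / 2 else 0
  | .inr (.inr (i, j, k)) => fun s =>
      Real.cos (w i * s) * Real.cos (w j * s) * Real.cos (w k * s)

theorem NonResonant.ditherOscillation {w : Fin m → ℝ} (hw : NonResonant w) (hpos : ∀ i, 0 < w i) :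
    ∀ α, HasBoundedPrimitive (ditherOscillation w α)
  | .inl i => .cos_mul (hpos i).ne'
  | .inr (.inl (i, j)) => hw.cos_mul_cos hpos i j
  | .inr (.inr (i, j, k)) => hw.cos_mul_cos_mul_cos hpos i j k

/-- With the Hessian frozen at the origin, the cubic amplitude is linear in `y`, so `C²` regularity
of `G` suffices. -/
theorem ContDiffAt.ditherAmplitude {G : Vec m → ℝ} {y : Vec m} (hG : ContDiffAt ℝ 2 G y) (ε : ℝ) :
    ∀ α, ContDiffAt ℝ 1 (ditherAmplitude G ε α) y := by
  have h0 : ∀ i, ContDiffAt ℝ 1 (fun y : Vec m => y i) y := fun i => by fun_prop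
  have h1 : ContDiffAt ℝ 1 G y := hG.of_le (by norm_num)
  have h2 : ContDiffAt ℝ 1 (fderiv ℝ G) y := hG.fderiv_right (by norm_num)
  rintro (i | ⟨i, j⟩ | ⟨i, j, k⟩)
  · exact contDiffAt_const.mul ((h0 i).mul h1)
  · exact contDiffAt_const.mul ((h0 i).mul (h2.clm_apply contDiffAt_const))
  · exact contDiffAt_const.mul ((h0 i).mul contDiffAt_const)

/-- The bracket is the frozen Taylor polynomial of `G(y - εc)`. The last term compensates the mean
`-ε² G'(y)y` of the quadratic products, leaving purely oscillating terms. -/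
theorem sum_ditherOscillation_mul (G : Vec m → ℝ) (ε : ℝ) (w : Fin m → ℝ) (s : ℝ) (y : Vec m) :
    ∑ α, ditherOscillation w α s * ditherAmplitude G ε α y =
      2 * ε * inner ℝ y (cosVec w s) * (G y - ε * fderiv ℝ G y (cosVec w s)
        + ε ^ 2 / 2 * fderiv ℝ (fderiv ℝ G) 0 (cosVec w s) (cosVec w s))
        + ε ^ 2 * fderiv ℝ G y y := by
  set D := fderiv ℝ G y with hD
  set H := fderiv ℝ (fderiv ℝ G) 0 with hH
  set c := cosVec w s with hc
  have hci : ∀ i, Real.cos (w i * s) = c i := fun i => rfl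
  have hin : inner ℝ y c = ∑ i, y i * c i := by
    simp [PiLp.inner_apply, mul_comm]
  have hHcc : H c c = ∑ j, ∑ k, c j * c k * H (EuclideanSpace.single j 1)
      (EuclideanSpace.single k 1) := by
    have e1 : H c c = ∑ j, c j * H (EuclideanSpace.single j 1) c :=
      Vec.clm_apply_eq_sum (H.flip c) c
    rw [e1]
    refine Finset.sum_congr rfl fun j _ => ?_
    rw [Vec.clm_apply_eq_sum (H (EuclideanSpace.single j 1)) c, Finset.mul_sum]
    exact Finset.sum_congr rfl fun k _ => by ring
  rw [Fintype.sum_sum_type, Fintype.sum_sum_type]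
  simp only [Fintype.sum_prod_type, ditherOscillation, ditherAmplitude, ← hD, ← hH, hci]
  have s1 : ∑ i, c i * (2 * ε * (y i * G y)) = 2 * ε * inner ℝ y c * G y := by
    rw [hin, Finset.mul_sum, Finset.sum_mul]
    exact Finset.sum_congr rfl fun i _ => by ring
  have s2 : ∑ i, ∑ j, (c i * c j - if i = j then 1 / 2 else 0) *
      (-2 * ε ^ 2 * (y i * D (EuclideanSpace.single j 1))) =
      -2 * ε ^ 2 * (inner ℝ y c * D c) + ε ^ 2 * D y := by
    have e1 : ∀ i, ∑ j, (c i * c j - if i = j then 1 / 2 else 0) *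
        (-2 * ε ^ 2 * (y i * D (EuclideanSpace.single j 1))) =
        -2 * ε ^ 2 * (y i * c i * D c) + ε ^ 2 * (y i * D (EuclideanSpace.single i 1)) := by
      intro i
      simp only [sub_mul, Finset.sum_sub_distrib, ite_mul, zero_mul, Finset.sum_ite_eq,
        Finset.mem_univ, if_true]
      rw [Vec.clm_apply_eq_sum D c, Finset.mul_sum, Finset.mul_sum]
      have : ∀ j, c i * c j * (-2 * ε ^ 2 * (y i * D (EuclideanSpace.single j 1))) =
        -2 * ε ^ 2 * (y i * c i * (c j * D (EuclideanSpace.single j 1))) := fun j => by ring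
      rw [Finset.sum_congr rfl fun j _ => this j]
      ring
    rw [Finset.sum_congr rfl fun i _ => e1 i, Finset.sum_add_distrib, ← Finset.mul_sum,
      ← Finset.mul_sum, ← Finset.sum_mul, ← hin, ← Vec.clm_apply_eq_sum D y]
  have s3 : ∑ i, ∑ j, ∑ k, c i * c j * c k * (ε ^ 3 * (y i * H (EuclideanSpace.single j 1)
      (EuclideanSpace.single k 1))) = ε ^ 3 * (inner ℝ y c * H c c) := by
    rw [hin, hHcc, Finset.sum_mul, Finset.mul_sum]
    refine Finset.sum_congr rfl fun i _ => ?_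
    rw [Finset.mul_sum, Finset.mul_sum]
    refine Finset.sum_congr rfl fun j _ => ?_
    rw [Finset.mul_sum, Finset.mul_sum]
    exact Finset.sum_congr rfl fun k _ => by ring
  rw [s1, s2, s3]
  ring

end Dither

/-! ### Convergence of the normalized extremum-seeking law. -/

section Seek

variable {m : ℕ}

/-- The right-hand side of the normalized extremum-seeking law. -/
noncomputable def seekField (G : Vec m → ℝ) (ε : ℝ) (w : Fin m → ℝ) (s : ℝ) (y : Vec m) : Vec m :=
  (ε * G (y - ε • cosVec w s)) • cosVec w s

/-- Extremum seeking near a nondegenerate minimum: decay of the squared parameter error, as long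
as the probing signal stays in a fixed neighbourhood of the minimum. -/
theorem exists_seek_sq_bound (hm : 0 < m) {G : Vec m → ℝ} (hG : ContDiffAt ℝ 2 G 0)
    (h0 : fderiv ℝ G 0 = 0) {c : ℝ} (hc : 0 < c)
    (hgrow : ∀ᶠ y in 𝓝 (0 : Vec m), G 0 + c * ‖y‖ ^ 2 ≤ G y) :
    ∃ R : ℝ, 0 < R ∧ ∀ ε : ℝ, 0 < ε → ∀ w : Fin m → ℝ, NonResonant w → (∀ i, 0 < w i) →
      ∃ κ₀ : ℝ, 0 < κ₀ ∧ ∀ κ : ℝ, κ₀ < κ → ∀ (T : ℝ) (y : ℝ → Vec m),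
        (∀ t ∈ Set.Icc 0 T, ‖y t‖ + ε * √m ≤ R) →
        (∀ t ∈ Set.Icc 0 T,
          HasDerivWithinAt y (seekField G ε w (κ * t) (y t)) (Set.Icc 0 T) t) →
        ∀ t ∈ Set.Icc 0 T,
          ‖y t‖ ^ 2 ≤ Real.exp (-(ε ^ 2 * c / 2) * t) * ‖y 0‖ ^ 2 + ε ^ 2 := by
  have hm1 : (1 : ℝ) ≤ m := by exact_mod_cast hm
  -- Small enough for strong monotonicity (`3δ ≤ c`) and for the Taylor remainder to contribute at
  -- most `ε²/2` below.
  set δ := c / (3 * (m : ℝ) ^ 2) with hδ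
  have hδ0 : 0 < δ := by positivity
  have hδm : 3 * (m : ℝ) ^ 2 * δ = c := by rw [hδ]; field_simp
  have hδc : 3 * δ ≤ c := by nlinarith [one_le_pow₀ hm1 (n := 2)]
  obtain ⟨R, hR, hcd, htay, hmono⟩ := hG.exists_taylor_of_growth h0 hgrow hδ0 hδc
  refine ⟨R, hR, fun ε hε w hw hpos => ?_⟩
  obtain ⟨M, hM⟩ := (isCompact_closedBall (0 : Vec m) R).exists_bound_of_continuousOn
    fun y hy => (hcd y hy).continuousAt.continuousWithinAt
  have hM0 : 0 ≤ M := (norm_nonneg _).trans (hM 0 (by simpa using hR.le))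
  set l := ε ^ 2 * c / 2 with hl
  have hl0 : 0 < l := by positivity
  -- This is the constant left by Young's inequality for the remainder; half of the averaged decay
  -- `ε² c` is spent there, so `l = ε² c / 2` survives.
  set b := 2 * δ ^ 2 * (m : ℝ) ^ 3 * ε ^ 4 / c with hb
  obtain ⟨C, hC0, hC⟩ := exists_averaging_bound (hw.ditherOscillation hpos)
    (fun α y hy => (hcd y hy).ditherAmplitude ε α) hl0 (by positivity : 0 ≤ b)
    (by positivity : 0 ≤ ε * M * √m)
  -- This threshold makes the averaging error `C / κ` at most `ε²/2`.
  refine ⟨2 * C / ε ^ 2 + 1, by positivity, fun κ hκ T y hyR hy t ht => ?_⟩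
  have hκ0 : 0 < κ := lt_trans (by positivity) hκ
  have hmem1 : ∀ t ∈ Set.Icc 0 T, y t ∈ Metric.closedBall (0 : Vec m) R := fun t ht => by
    have : 0 ≤ ε * √m := by positivity
    simpa using by linarith [hyR t ht]
  have hεc : ∀ s, ‖ε • cosVec w s‖ ≤ ε * √m := fun s => by
    rw [norm_smul, Real.norm_of_nonneg hε.le]
    exact mul_le_mul_of_nonneg_left (norm_cosVec_le w s) hε.le
  have hmem2 : ∀ t ∈ Set.Icc 0 T, ∀ s,
      y t - ε • cosVec w s ∈ Metric.closedBall (0 : Vec m) R := fun t ht s => by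
    simpa using (norm_sub_le _ _).trans (by linarith [hyR t ht, hεc s])
  have hyc : ContinuousOn y (Set.Icc 0 T) := fun t ht => (hy t ht).continuousWithinAt
  have hyd : ∀ t ∈ Set.Ioo 0 T, HasDerivAt y (seekField G ε w (κ * t) (y t)) t := fun t ht =>
    (hy t (Set.Ioo_subset_Icc_self ht)).hasDerivAt (Icc_mem_nhds ht.1 ht.2)
  have key := hC κ hκ0 T y (fun t => seekField G ε w (κ * t) (y t)) (fun t => ‖y t‖ ^ 2)
    (fun t => 2 * inner ℝ (y t) (seekField G ε w (κ * t) (y t))) hmem1 hyc ?_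
    (hyc.norm.pow 2) ?_ t ht
  · have h1 : C / κ ≤ ε ^ 2 / 2 := by
      rw [div_le_iff₀ hκ0]
      have : 2 * C / ε ^ 2 < κ := by linarith
      rw [div_lt_iff₀ (by positivity)] at this
      linarith
    have h2 : b / l ≤ ε ^ 2 / 2 := by
      rw [hb, hl, ← hδm]
      have : 2 * δ ^ 2 * (m : ℝ) ^ 3 * ε ^ 4 / (3 * (m : ℝ) ^ 2 * δ)
          / (ε ^ 2 * (3 * (m : ℝ) ^ 2 * δ) / 2) = 4 / 9 * ε ^ 2 / m := by
        field_simp; ring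
      rw [this, div_le_iff₀ (by positivity)]
      nlinarith [sq_nonneg ε]
    linarith
  · intro t ht
    refine ⟨hyd t ht, ?_⟩
    have ht' := Set.Ioo_subset_Icc_self ht
    rw [seekField, norm_smul, norm_mul, Real.norm_of_nonneg hε.le]
    exact mul_le_mul (mul_le_mul_of_nonneg_left (hM _ (hmem2 t ht' _)) hε.le) (norm_cosVec_le _ _)
      (norm_nonneg _) (by positivity)
  · intro t ht
    have ht' := Set.Ioo_subset_Icc_self ht
    refine ⟨(hyd t ht).norm_sq, ?_⟩
    rw [sum_ditherOscillation_mul, seekField, inner_smul_right]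
    have h1 := htay (y t) (hmem1 t ht') (y t - ε • cosVec w (κ * t)) (hmem2 t ht' _)
    have h2 := hmono (y t) (hmem1 t ht')
    have hcn := norm_cosVec_le w (κ * t)
    set Y := y t
    set cv := cosVec w (κ * t)
    have e1 : Y - ε • cv - Y = -(ε • cv) := by abel
    rw [e1] at h1
    simp only [map_neg, map_smul, neg_apply, smul_apply, smul_eq_mul, norm_neg, norm_smul,
      Real.norm_of_nonneg hε.le] at h1
    set D := fderiv ℝ G Y
    set H := fderiv ℝ (fderiv ℝ G) 0
    set r := G (Y - ε • cv) - (G Y + -(ε * D cv) + 1 / 2 * (ε * (ε * H cv cv))) with hr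
    have hm0 : √(m : ℝ) ^ 2 = m := Real.sq_sqrt (by positivity)
    have hrb : |r| ≤ δ * (ε ^ 2 * m) := by
      have hr' : r = G (Y - ε • cv) - (G Y + -(ε * D cv) + 1 / 2 * -(ε * -(ε * H cv cv))) := by
        rw [hr]; ring
      rw [hr']
      refine h1.trans (mul_le_mul_of_nonneg_left ?_ hδ0.le)
      rw [mul_pow, ← hm0]
      gcongr
    have hs : |inner ℝ Y cv| ≤ ‖Y‖ * √m :=
      (abs_real_inner_le_norm _ _).trans (mul_le_mul_of_nonneg_left hcn (norm_nonneg _))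
    have hsr : inner ℝ Y cv * r ≤ ‖Y‖ * √m * (δ * (ε ^ 2 * m)) := by
      refine (le_abs_self _).trans ?_
      rw [abs_mul]
      exact mul_le_mul hs hrb (abs_nonneg _) (by positivity)
    have hyoung : 2 * ε * (‖Y‖ * √m * (δ * (ε ^ 2 * m))) ≤ ε ^ 2 * c / 2 * ‖Y‖ ^ 2 + b := by
      have e2 : 2 * c * b = (2 * ε ^ 2 * δ * m * √m) ^ 2 := by
        rw [hb, mul_pow, hm0]; field_simp
      have e3 : 2 * c * (ε ^ 2 * c / 2 * ‖Y‖ ^ 2) = (ε * c * ‖Y‖) ^ 2 := by ring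
      have e4 : 2 * c * (2 * ε * (‖Y‖ * √m * (δ * (ε ^ 2 * m)))) =
          2 * (ε * c * ‖Y‖) * (2 * ε ^ 2 * δ * m * √m) := by ring
      have := two_mul_le_add_sq (ε * c * ‖Y‖) (2 * ε ^ 2 * δ * m * √m)
      have h5 : 2 * c * (2 * ε * (‖Y‖ * √m * (δ * (ε ^ 2 * m)))) ≤
          2 * c * (ε ^ 2 * c / 2 * ‖Y‖ ^ 2 + b) := by
        rw [mul_add, e2, e3, e4]; exact this
      exact le_of_mul_le_mul_left h5 (by positivity)
    have hGv : G (Y - ε • cv) = r + (G Y + -(ε * D cv) + 1 / 2 * (ε * (ε * H cv cv))) := by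
      rw [hr]; ring
    rw [hGv]
    have h3 : 2 * ε * (inner ℝ Y cv * r) ≤ 2 * ε * (‖Y‖ * √m * (δ * (ε ^ 2 * m))) :=
      mul_le_mul_of_nonneg_left hsr (by positivity)
    have h4 : ε ^ 2 * (c * ‖Y‖ ^ 2) ≤ ε ^ 2 * D Y := mul_le_mul_of_nonneg_left h2 (by positivity)
    rw [hl]
    linarith

/-- Extremum seeking near a nondegenerate minimum: invariance of a neighbourhood and decay of the
parameter error. -/
theorem exists_seek_bound (hm : 0 < m) {G : Vec m → ℝ} (hG : ContDiffAt ℝ 2 G 0)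
    (h0 : fderiv ℝ G 0 = 0) {c : ℝ} (hc : 0 < c)
    (hgrow : ∀ᶠ y in 𝓝 (0 : Vec m), G 0 + c * ‖y‖ ^ 2 ≤ G y) :
    ∃ R : ℝ, 0 < R ∧ ∀ ε : ℝ, 0 < ε → ∀ w : Fin m → ℝ, NonResonant w → (∀ i, 0 < w i) →
      ∃ κ₀ : ℝ, 0 < κ₀ ∧ ∀ κ : ℝ, κ₀ < κ → ∀ (T : ℝ) (y : ℝ → Vec m),
        ‖y 0‖ + ε + ε * √m < R →
        (∀ t ∈ Set.Icc 0 T,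
          HasDerivWithinAt y (seekField G ε w (κ * t) (y t)) (Set.Icc 0 T) t) →
        ∀ t ∈ Set.Icc 0 T, ‖y t‖ ≤ Real.exp (-(ε ^ 2 * c / 4) * t) * ‖y 0‖ + ε := by
  obtain ⟨R, hR, h⟩ := exists_seek_sq_bound hm hG h0 hc hgrow
  refine ⟨R, hR, fun ε hε w hw hpos => ?_⟩
  obtain ⟨κ₀, hκ₀, h⟩ := h ε hε w hw hpos
  refine ⟨κ₀, hκ₀, fun κ hκ T y hy0 hy => ?_⟩
  have hstep : ∀ T' ≤ T, (∀ t ∈ Set.Icc 0 T', ‖y t‖ + ε * √m ≤ R) → ∀ t ∈ Set.Icc 0 T',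
      ‖y t‖ ≤ Real.exp (-(ε ^ 2 * c / 4) * t) * ‖y 0‖ + ε := by
    intro T' hT' hin t ht
    have hsub : Set.Icc 0 T' ⊆ Set.Icc 0 T := Set.Icc_subset_Icc_right hT'
    have h1 := h κ hκ T' y hin (fun s hs => (hy s (hsub hs)).mono hsub) t ht
    have h2 : Real.exp (-(ε ^ 2 * c / 2) * t) = Real.exp (-(ε ^ 2 * c / 4) * t) ^ 2 := by
      rw [← Real.exp_nat_mul]; congr 1; push_cast; ring
    refine le_of_sq_le_sq (h1.trans ?_) (by positivity)
    rw [h2]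
    have : 0 ≤ Real.exp (-(ε ^ 2 * c / 4) * t) * ‖y 0‖ * ε := by positivity
    nlinarith
  have hyc : ContinuousOn y (Set.Icc 0 T) := fun t ht => (hy t ht).continuousWithinAt
  suffices hlt : ∀ t ∈ Set.Icc 0 T, ‖y t‖ + ε * √m < R from
    hstep T le_rfl fun t ht => (hlt t ht).le
  by_contra! hbad
  have hcl : IsCompact (Set.Icc 0 T ∩ (fun t => ‖y t‖ + ε * √m) ⁻¹' Set.Ici R) :=
    isCompact_Icc.of_isClosed_subset
      ((hyc.norm.add continuousOn_const).preimage_isClosed_of_isClosed isClosed_Icc isClosed_Ici)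
      Set.inter_subset_left
  obtain ⟨t, ht, htR⟩ := hbad
  -- At the first exit time, the decay estimate valid before it passes to the limit and contradicts
  -- the exit.
  obtain ⟨t₀, ⟨ht₀, ht₀R⟩, hmin⟩ := hcl.exists_isLeast ⟨t, ht, htR⟩
  have hbefore : ∀ s ∈ Set.Icc 0 T, s < t₀ → ‖y s‖ + ε * √m < R := fun s hs hst => by
    by_contra! hsR
    exact absurd (hmin ⟨hs, hsR⟩) (not_le.2 hst)
  have hpos0 : 0 < t₀ := by
    rcases ht₀.1.eq_or_lt with h | h
    · have h1 : R ≤ ‖y t₀‖ + ε * √m := ht₀R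
      rw [← h] at h1
      linarith
    · exact h
  have hlow : ∀ s ∈ Set.Ioo 0 t₀, ‖y s‖ ≤ ‖y 0‖ + ε := fun s hs => by
    have hsT : s ≤ T := hs.2.le.trans ht₀.2
    refine (hstep s hsT (fun r hr => (hbefore r ⟨hr.1, hr.2.trans hsT⟩
      (hr.2.trans_lt hs.2)).le) s ⟨hs.1.le, le_rfl⟩).trans ?_
    have : Real.exp (-(ε ^ 2 * c / 4) * s) ≤ 1 := Real.exp_le_one_iff.2 (by
      have : 0 ≤ ε ^ 2 * c / 4 * s := mul_nonneg (by positivity) hs.1.le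
      linarith)
    nlinarith [norm_nonneg (y 0)]
  have hlim : ‖y t₀‖ ≤ ‖y 0‖ + ε := by
    have hne : (𝓝[Set.Ioo 0 t₀] t₀).NeBot := by
      rw [← mem_closure_iff_nhdsWithin_neBot, closure_Ioo hpos0.ne]
      exact ⟨hpos0.le, le_rfl⟩
    refine le_of_tendsto ((hyc.norm t₀ ht₀).mono fun s (hs : s ∈ Set.Ioo 0 t₀) => ⟨hs.1.le, hs.2.le.trans ht₀.2⟩) ?_
    filter_upwards [self_mem_nhdsWithin] with s hs
    exact hlow s hs
  have h1 : R ≤ ‖y t₀‖ + ε * √m := ht₀R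
  linarith

end Seek

/-! ### Return to the original coordinates. -/

section Scaling

variable {m : ℕ}

/-- Coordinatewise multiplication by `a`. -/
noncomputable def scale (a : Fin m → ℝ) (v : Vec m) : Vec m :=
  WithLp.toLp 2 fun i => a i * v i

theorem contDiff_scale (a : Fin m → ℝ) {k : WithTop ℕ∞} : ContDiff ℝ k (scale a) := by
  rw [contDiff_euclidean]
  intro i
  simp only [scale]
  fun_prop

theorem norm_scale_le (a : Fin m → ℝ) {v : Vec m} {K : ℝ} (hK : 0 ≤ K) (hv : ∀ i, |v i| ≤ K) :
    ‖scale a v‖ ≤ √(∑ i, a i ^ 2) * K := by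
  rw [EuclideanSpace.norm_eq]
  refine Real.sqrt_le_iff.2 ⟨by positivity, ?_⟩
  rw [mul_pow, Real.sq_sqrt (by positivity), Finset.sum_mul]
  refine Finset.sum_le_sum fun i _ => ?_
  rw [Real.norm_eq_abs, sq_abs, scale, mul_pow]
  exact mul_le_mul_of_nonneg_left (sq_le_sq.2 ((hv i).trans (le_abs_self K))) (sq_nonneg _)

theorem mul_norm_le_norm_scale {a : Fin m → ℝ} {α : ℝ} (hα : 0 ≤ α) (ha : ∀ i, α ≤ a i)
    (v : Vec m) : α * ‖v‖ ≤ ‖scale a v‖ := by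
  refine le_of_sq_le_sq ?_ (norm_nonneg _)
  rw [mul_pow, EuclideanSpace.norm_sq_eq, EuclideanSpace.norm_sq_eq, Finset.mul_sum]
  refine Finset.sum_le_sum fun i _ => ?_
  rw [scale, norm_mul, mul_pow, Real.norm_of_nonneg (hα.trans (ha i))]
  gcongr
  exact ha i

theorem hasDerivWithinAt_vec {y : ℝ → Vec m} {y' : Vec m} {s : Set ℝ} {t : ℝ}
    (h : ∀ i, HasDerivWithinAt (fun r => y r i) (y' i) s t) : HasDerivWithinAt y y' s t := by
  rw [hasDerivWithinAt_iff_hasFDerivWithinAt, hasFDerivWithinAt_euclidean]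
  intro i
  refine (h i).hasFDerivWithinAt.congr_fderiv ?_
  ext
  simp

theorem exists_pos_lower_bound (hm : 0 < m) {a : Fin m → ℝ} (ha : ∀ i, 0 < a i) :
    ∃ α, 0 < α ∧ ∀ i, α ≤ a i := by
  have : Nonempty (Fin m) := ⟨⟨0, hm⟩⟩
  obtain ⟨i, hi⟩ := Finite.exists_min a
  exact ⟨a i, ha i, hi⟩

end Scaling

/-- Near a nondegenerate minimum of an analytic cost, the extremum-seeking estimate approaches the
parameter exponentially, up to an error proportional to the amplitudes. -/
theorem exists_estimate_bound {m : ℕ} (hm : 0 < m) {J : Vec m → ℝ} {θ : Vec m}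
    (hJ : AnalyticAt ℝ J θ) (hnd : IsNondegenerateMin J θ) {a : Fin m → ℝ} (ha : ∀ i, 0 < a i) :
    ∃ ρ ε₀ A k : ℝ, 0 < ρ ∧ 0 < ε₀ ∧ 0 < A ∧ 0 < k ∧ ∀ ε : ℝ, 0 < ε → ε < ε₀ →
      ∀ w : Fin m → ℝ, NonResonant w → (∀ i, 0 < w i) →
        ∃ κ₀ : ℝ, 0 < κ₀ ∧ ∀ κ : ℝ, κ₀ < κ → ∀ (T : ℝ) (η : ℝ → Vec m), 0 ≤ T →
          (∀ t ∈ Set.Icc 0 T, ∀ i, HasDerivWithinAt (fun s => η s i)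
            (ε * a i * Real.sin (κ * w i * t + Real.pi / 2) *
              J (estimate (fun i => ε * a i) (fun i => κ * w i) η t)) (Set.Icc 0 T) t) →
          ‖θ - estimate (fun i => ε * a i) (fun i => κ * w i) η 0‖ < ρ →
          ∀ t ∈ Set.Icc 0 T, ‖θ - estimate (fun i => ε * a i) (fun i => κ * w i) η t‖ ≤
            A * ‖θ - estimate (fun i => ε * a i) (fun i => κ * w i) η 0‖
                * Real.exp (-(ε ^ 2 * k) * t)
              + (√m + 2) * √(∑ i, (ε * a i) ^ 2) := by
  obtain ⟨α, hα, haα⟩ := exists_pos_lower_bound hm ha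
  obtain ⟨c, hc, hgrow⟩ := hnd
  set G : Vec m → ℝ := fun y => J (θ + scale a y) with hG
  have hs0 : θ + scale a 0 = θ := by
    ext i
    simp [scale]
  have hsc : ContinuousAt (fun y => θ + scale a y) 0 :=
    (continuous_const.add (contDiff_scale a (k := 0)).continuous).continuousAt
  have hG2 : ContDiffAt ℝ 2 G 0 := by
    have h1 : ContDiffAt ℝ 2 J (θ + scale a 0) := by rw [hs0]; exact hJ.contDiffAt
    exact h1.comp (0 : Vec m) (contDiff_const.add (contDiff_scale a)).contDiffAt
  have hGgrow : ∀ᶠ y in 𝓝 (0 : Vec m), G 0 + c * α ^ 2 * ‖y‖ ^ 2 ≤ G y := by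
    have h1 : Filter.Tendsto (fun y => θ + scale a y) (𝓝 0) (𝓝 θ) := by
      simpa only [ContinuousAt, hs0] using hsc
    filter_upwards [h1.eventually hgrow] with y hy
    have h2 := mul_norm_le_norm_scale hα.le haα y
    have h3 : (α * ‖y‖) ^ 2 ≤ ‖scale a y‖ ^ 2 := by gcongr
    rw [add_sub_cancel_left] at hy
    simp only [hG, hs0]
    have h4 := mul_le_mul_of_nonneg_left h3 hc.le
    rw [mul_pow] at h4
    linarith
  have hcrit : fderiv ℝ G 0 = 0 := by
    refine IsLocalMin.fderiv_eq_zero (hGgrow.mono fun y hy => ?_)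
    have : 0 ≤ c * α ^ 2 * ‖y‖ ^ 2 := by positivity
    linarith
  obtain ⟨R, hR, hseek⟩ := exists_seek_bound hm hG2 hcrit (c := c * α ^ 2) (by positivity) hGgrow
  have : Nonempty (Fin m) := ⟨⟨0, hm⟩⟩
  have hN : 0 < √(∑ i, a i ^ 2) :=
    Real.sqrt_pos.2 (Finset.sum_pos (fun i _ => pow_pos (ha i) 2) Finset.univ_nonempty)
  set N := √(∑ i, a i ^ 2) with hNdef
  -- The initial error uses half of `R`; the other half pays for `ε(2√m + 1)`: the dither at time
  -- zero, the margin `ε`, and the dither along the trajectory.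
  refine ⟨α * (R / 2), R / 2 / (2 * √m + 1), N / α, c * α ^ 2 / 4, by positivity, by positivity,
    by positivity, by positivity, fun ε hε hε₀ w hw hpos => ?_⟩
  obtain ⟨κ₀, hκ₀, hseek⟩ := hseek ε hε w hw hpos
  refine ⟨κ₀, hκ₀, fun κ hκ T η hT hη hini t ht => ?_⟩
  have hεN : √(∑ i, (ε * a i) ^ 2) = ε * N := by
    simp only [mul_pow]
    rw [← Finset.mul_sum, Real.sqrt_mul (by positivity), Real.sqrt_sq hε.le]
  set est := estimate (fun i => ε * a i) (fun i => κ * w i) η with hest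
  -- Dividing by `a i` rather than by `ε * a i` leaves `G`, and hence `R`, independent of `ε`.
  set y : ℝ → Vec m := fun s => WithLp.toLp 2 fun i => (η s i - θ i) / a i with hy
  have hesty : ∀ s, est s = θ + scale a (y s - ε • cosVec w (κ * s)) := by
    intro s
    ext i
    have h1 : Real.sin (κ * w i * s - Real.pi / 2) = -Real.cos (w i * (κ * s)) := by
      rw [Real.sin_sub_pi_div_two]; congr 2; ring
    have := (ha i).ne'
    simp only [hest, estimate, h1, scale, hy, cosVec, PiLp.add_apply, PiLp.sub_apply,
      PiLp.smul_apply, smul_eq_mul]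
    field_simp
    ring
  have hyd : ∀ s ∈ Set.Icc 0 T,
      HasDerivWithinAt y (seekField G ε w (κ * s) (y s)) (Set.Icc 0 T) s := by
    intro s hs
    refine hasDerivWithinAt_vec fun i => ?_
    have h1 := ((hη s hs i).sub_const (θ i)).div_const (a i)
    refine h1.congr_deriv ?_
    have h2 : Real.sin (κ * w i * s + Real.pi / 2) = Real.cos (w i * (κ * s)) := by
      rw [Real.sin_add_pi_div_two]; congr 1; ring
    have := (ha i).ne'
    rw [h2, hesty s]
    simp only [seekField, hG, cosVec, PiLp.smul_apply, smul_eq_mul]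
    field_simp
  have hy0 : ‖y 0‖ ≤ ‖θ - est 0‖ / α + ε * √m := by
    have h1 : θ - est 0 = -scale a (y 0 - ε • cosVec w (κ * 0)) := by rw [hesty 0]; abel
    have h2 := mul_norm_le_norm_scale hα.le haα (y 0 - ε • cosVec w (κ * 0))
    rw [← norm_neg (scale _ _), ← h1] at h2
    have h3 : ‖y 0 - ε • cosVec w (κ * 0)‖ ≤ ‖θ - est 0‖ / α := by
      rw [le_div_iff₀ hα]; linarith
    have h4 : ‖ε • cosVec w (κ * 0)‖ ≤ ε * √m := by
      rw [norm_smul, Real.norm_of_nonneg hε.le]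
      exact mul_le_mul_of_nonneg_left (norm_cosVec_le w _) hε.le
    linarith [norm_le_norm_sub_add (y 0) (ε • cosVec w (κ * 0))]
  have hsmall : ‖y 0‖ + ε + ε * √m < R := by
    have h1 : ‖θ - est 0‖ / α < R / 2 := by rw [div_lt_iff₀ hα]; linarith
    rw [lt_div_iff₀ (by positivity)] at hε₀
    linarith
  have hyt := hseek κ hκ T y hsmall hyd t ht
  have hexp : -(ε ^ 2 * (c * α ^ 2) / 4) * t = -(ε ^ 2 * (c * α ^ 2 / 4)) * t := by ring
  rw [hexp] at hyt
  set E := Real.exp (-(ε ^ 2 * (c * α ^ 2 / 4)) * t) with hE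
  have hE0 : 0 < E := Real.exp_pos _
  have hE1 : E ≤ 1 := Real.exp_le_one_iff.2 (by
    have : 0 ≤ ε ^ 2 * (c * α ^ 2 / 4) * t := mul_nonneg (by positivity) ht.1
    linarith)
  have hfin : ‖θ - est t‖ ≤ N * (‖y t‖ + ε) := by
    have h1 : θ - est t = -scale a (y t - ε • cosVec w (κ * t)) := by rw [hesty t]; abel
    rw [h1, norm_neg]
    refine norm_scale_le a (by positivity) fun i => ?_
    refine (abs_sub _ _).trans (add_le_add (PiLp.norm_apply_le (y t) i) ?_)
    change |ε * Real.cos (w i * (κ * t))| ≤ ε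
    rw [abs_mul, abs_of_pos hε]
    exact mul_le_of_le_one_right hε.le (Real.abs_cos_le_one _)
  have h5 : E * ‖y 0‖ ≤ E * (‖θ - est 0‖ / α) + ε * √m := by
    have h6 := mul_le_mul_of_nonneg_left hy0 hE0.le
    have : 0 ≤ ε * √m := by positivity
    nlinarith
  rw [hεN]
  calc ‖θ - est t‖ ≤ N * (‖y t‖ + ε) := hfin
    _ ≤ N * (E * (‖θ - est 0‖ / α) + ε * √m + ε + ε) := by gcongr; linarith
    _ = N / α * ‖θ - est 0‖ * E + (√m + 2) * (ε * N) := by field_simp; ring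

/-! ### Assembly of the two estimates. -/

theorem lemma1 (n p m : ℕ) (hm : 0 < m) (S : TrackingLoop n p m) (hS : S.Admissible) :
    ∃ (β : ℝ → ℝ → ℝ) (γ : ℝ → ℝ), ClassKL β ∧ ClassK γ ∧
      -- all amplitudes, any admissible cost; the gain may depend on the amplitudes
      (∀ a : Fin m → ℝ, (∀ i, 0 < a i) →
        ∃ γ' : ℝ → ℝ, ClassK γ' ∧ ∀ J : Vec m → ℝ, S.IsCost J →
          ∃ D ∈ 𝓝 (0 : Vec m), ∃ β' : ℝ → ℝ → ℝ, ClassKL β' ∧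
            ∃ ξ₁ wmin : ℝ, 0 < ξ₁ ∧ 0 < wmin ∧
              ∀ w : Fin m → ℝ, NonResonant w → (∀ i, wmin < w i) →
                S.BoundHolds J a w D β γ' β' ξ₁) ∧
      -- nondegenerate minimum, small amplitudes `ε a`, frequencies `κ w`; the gain depends neither
      -- on the cost nor on the amplitudes and frequencies
      (∀ J : Vec m → ℝ, S.IsCost J → IsNondegenerateMin J S.unc →
        ∀ a : Fin m → ℝ, (∀ i, 0 < a i) →
          ∃ D ∈ 𝓝 (0 : Vec m), ∃ ε₀ : ℝ, 0 < ε₀ ∧ ∀ ε : ℝ, 0 < ε → ε < ε₀ →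
            ∃ β' : ℝ → ℝ → ℝ, ClassKL β' ∧
              ∀ w : Fin m → ℝ, NonResonant w → (∀ i, 0 < w i) →
                ∃ ξ₁ wmin : ℝ, 0 < ξ₁ ∧ 0 < wmin ∧
                  ∀ κ : ℝ, (∀ i, wmin < κ * w i) →
                    S.BoundHolds J (fun i => ε * a i) (fun i => κ * w i) D β γ β' ξ₁) := by
  obtain ⟨C₀, C₁, k, hC₀, hC₁, hk, hiss⟩ := hS.exists_iss
  have : Nonempty (Fin m) := ⟨⟨0, hm⟩⟩
  refine ⟨fun r s => C₀ * r * Real.exp (-k * s), fun s => C₁ * (√m + 2) * s,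
    classKL_mul_exp hC₀ hk, classK_mul (by positivity), fun a ha => ?_,
    fun J hJ hnd a ha => ?_⟩
  · -- The robust controller alone keeps the effect of `Δ` below a constant.
    have hN : 0 < √(∑ i, a i ^ 2) :=
      Real.sqrt_pos.2 (Finset.sum_pos (fun i _ => pow_pos (ha i) 2) Finset.univ_nonempty)
    set N := √(∑ i, a i ^ 2) with hNdef
    -- The slope ensures `γ'(N) ≥ C₁‖Δ‖`; the neighbourhood, `β'`, `ξ₁` and the frequency threshold
    -- are then arbitrary.
    refine ⟨fun s => C₁ * (‖S.unc‖ / N + 1) * s, classK_mul (by positivity), fun J _ =>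
      ⟨Set.univ, Filter.univ_mem, fun r s => 1 * r * Real.exp (-1 * s),
        classKL_mul_exp one_pos one_pos, 1, 1, one_pos, one_pos, fun w _ hw => ?_⟩⟩
    intro T x sgn η hT hsol _ t ht
    refine (hiss J a w T x sgn η hT hsol 0 ‖S.unc‖ 0 le_rfl (norm_nonneg _) hk.le
      (fun s _ => by simp) t ht).trans (add_le_add_right ?_ _)
    have h1 : 0 ≤ ⨆ i, w i := Real.iSup_nonneg fun i => (one_pos.trans (hw i)).le
    have h2 : N ≤ 1 * ‖S.unc - estimate a w η 0‖ * Real.exp (-1 * t) + 1 / (⨆ i, w i) + N := by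
      have : 0 ≤ 1 * ‖S.unc - estimate a w η 0‖ * Real.exp (-1 * t) + 1 / (⨆ i, w i) := by
        positivity
      linarith
    have h3 : ‖S.unc‖ ≤ (‖S.unc‖ / N + 1) * N := by
      rw [add_mul, div_mul_cancel₀ _ hN.ne']; linarith
    calc C₁ * (0 * Real.exp (-0 * t) + ‖S.unc‖) = C₁ * ‖S.unc‖ := by ring
      _ ≤ C₁ * ((‖S.unc‖ / N + 1) * N) := by gcongr
      _ = C₁ * (‖S.unc‖ / N + 1) * N := by ring
      _ ≤ _ := mul_le_mul_of_nonneg_left h2 (by positivity)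
  · obtain ⟨-, -, V, hV, -, han, -⟩ := hJ
    obtain ⟨ρ, ε₀, A, q, hρ, hε₀, hA, hq, hest⟩ :=
      exists_estimate_bound hm (han _ (mem_of_mem_nhds hV)) hnd ha
    refine ⟨Metric.ball 0 ρ, Metric.ball_mem_nhds _ hρ, ε₀, hε₀, fun ε hε hεlt => ?_⟩
    -- The stability estimate admits only forcing that decays no faster than `k`.
    set μ := min k (ε ^ 2 * q) with hμ
    have hμ0 : 0 < μ := lt_min hk (by positivity)
    refine ⟨fun r s => A * r * Real.exp (-μ * s), classKL_mul_exp hA hμ0, fun w hw hpos => ?_⟩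
    obtain ⟨κ₀, hκ₀, hest⟩ := hest ε hε hεlt w hw hpos
    -- One coordinate of the frequency condition already forces `κ > κ₀`; the term `ξ₁/ω₀` is spare,
    -- since the averaging error went into the amplitude term.
    refine ⟨1, κ₀ * w ⟨0, hm⟩, one_pos, mul_pos hκ₀ (hpos _), fun κ hκ => ?_⟩
    have hκ' : κ₀ < κ := lt_of_mul_lt_mul_right (hκ ⟨0, hm⟩) (hpos _).le
    intro T x sgn η hT hsol hini t ht
    set e₀ := ‖S.unc - estimate (fun i => ε * a i) (fun i => κ * w i) η 0‖ with he₀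
    set N := √(∑ i, (ε * a i) ^ 2) with hN
    have he : ∀ s ∈ Set.Icc 0 T,
        ‖S.unc‖ - ‖estimate (fun i => ε * a i) (fun i => κ * w i) η s‖ ≤
          A * e₀ * Real.exp (-μ * s) + (√m + 2) * N := by
      intro s hs
      refine (norm_sub_norm_le _ _).trans
        ((hest κ hκ' T η hT.le hsol.seek (by simpa using hini) s hs).trans ?_)
      have : -(ε ^ 2 * q) * s ≤ -μ * s :=
        mul_le_mul_of_nonneg_right (neg_le_neg (min_le_right _ _)) hs.1
      gcongr
    refine (hiss J _ _ T x sgn η hT hsol (A * e₀) ((√m + 2) * N) μ (by positivity) (by positivity)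
      (min_le_left _ _) he t ht).trans (add_le_add_right ?_ _)
    have h1 : 0 ≤ ⨆ i, κ * w i :=
      Real.iSup_nonneg fun i => (mul_pos (hκ₀.trans hκ') (hpos i)).le
    have h2 : 0 ≤ 1 / ⨆ i, κ * w i := by positivity
    have h3 : 0 ≤ A * e₀ * Real.exp (-μ * t) := by positivity
    have h4 : (0 : ℝ) ≤ √m := Real.sqrt_nonneg _
    have h5 : A * e₀ * Real.exp (-μ * t) + (√m + 2) * N ≤
        (√m + 2) * (A * e₀ * Real.exp (-μ * t) + 1 / (⨆ i, κ * w i) + N) := by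
      nlinarith [mul_nonneg h4 h2, mul_nonneg h4 h3]
    exact (mul_le_mul_of_nonneg_left h5 hC₁.le).trans_eq (mul_assoc _ _ _).symm
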